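/- Let $N > 1$ be an integer and let $k$ be an integer relatively prime to $N$. For $\tau$ in the upper half plane $H$ let $L_\tau = \mathbb{Z}\cdot 2\pi i + \mathbb{Z}\cdot 2\pi i\tau$, and put $$g_2(\tau) = (2\pi i)^4\cdot 60 \sum_{0\ne w\in L_\tau} w^{-4},\qquad g_3(\tau) = (2\pi i)^6\cdot 140 \sum_{0\ne w\in L_\tau} w^{-6},$$ $$\Delta = g_2^3 - 27 g_3^2,\qquad j = g_2^3/\Delta,\qquad p_k(\tau) = \wp\bigl(L_\tau, 2\pi i k/N\bigr),\qquad f_k = g_2\, g_3\, p_k/\Delta,$$ where $\wp(L,u) = u^{-2} + \sum_{0\ne w\in L}\bigl((w-u)^{-2} - w^{-2}\bigr)$ is the Weierstrass $\wp$-function. Let $\Gamma_1(N)$ be the group of matrices $\begin{pmatrix} a&b\\ c&d\end{pmatrix}\in SL_2(\mathbb{Z})$ with $c\equiv 0$ and $a\equiv d\equiv 1 \pmod N$. A modular function for $\Gamma_1(N)$ is a meromorphic function $f$ on $H$ such that $f(\gamma\tau) = f(\tau)$ for all $\gamma\in\Gamma_1(N)$ and such that, for every $\gamma\in SL_2(\mathbb{Z})$,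 the function $f(\gamma\tau)$ is, for $\operatorname{Im}\tau$ large, a function of $e^{2\pi i\tau/N}$ that is meromorphic at $0$. Then $j$ and $f_k$ are meromorphic on $H$, and the subfield $\mathbb{C}(j, f_k)$ of the field of meromorphic functions on $H$ is the field of all modular functions for $\Gamma_1(N)$. -/

import Mathlib

open Filter Topology UpperHalfPlane
open scoped MatrixGroups

noncomputable section

namespace ModularFunctions

/-! ### The field of meromorphic functions on the upper half plane -/

/-- A function on the upper half plane is meromorphic if it is meromorphic at each point. -/
def IsMeromorphic (f : ℍ → ℂ) : Prop :=
  ∀ τ : ℍ, MeromorphicAt (fun z : ℂ => f (ofComplex z)) (τ : ℂ)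

/-- The `ℂ`-algebra of meromorphic functions `ℍ → ℂ` (functions with some value assigned at each
pole). -/
def meromorphicAlgebra : Subalgebra ℂ (ℍ → ℂ) where
  carrier := {f | IsMeromorphic f}
  mul_mem' := fun hf hg τ => (hf τ).mul (hg τ)
  add_mem' := fun hf hg τ => (hf τ).add (hg τ)
  algebraMap_mem' := fun c τ => MeromorphicAt.const c (τ : ℂ)

/-- The ideal of meromorphic functions that vanish outside a closed discrete subset of `ℍ`. -/
def negligibleIdeal : Ideal meromorphicAlgebra where
  carrier := {f | ∀ᶠ τ in codiscrete ℍ, f.1 τ = 0}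
  zero_mem' := by
    change ∀ᶠ τ in codiscrete ℍ, (0 : ℂ) = 0
    simp
  add_mem' := by
    intro f g hf hg
    change ∀ᶠ τ in codiscrete ℍ, f.1 τ = 0 at hf
    change ∀ᶠ τ in codiscrete ℍ, g.1 τ = 0 at hg
    change ∀ᶠ τ in codiscrete ℍ, f.1 τ + g.1 τ = 0
    filter_upwards [hf, hg] with τ h1 h2
    rw [h1, h2, add_zero]
  smul_mem' := by
    intro c f hf
    change ∀ᶠ τ in codiscrete ℍ, f.1 τ = 0 at hf
    change ∀ᶠ τ in codiscrete ℍ, c.1 τ * f.1 τ = 0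
    filter_upwards [hf] with τ h1
    rw [h1, mul_zero]

lemma codiscrete_neBot : (codiscrete ℍ).NeBot := by
  rw [neBot_iff]
  intro h
  have h1 : (∅ : Set ℍ) ∈ codiscrete ℍ := by rw [h]; trivial
  rw [← isOpenEmbedding_coe.isEmbedding.image_mem_codiscreteWithin_range, Set.image_empty,
    mem_codiscreteWithin_iff_forall_mem_nhdsNE] at h1
  have h2 := h1 _ ⟨UpperHalfPlane.I, rfl⟩
  have h3 := inter_mem h2 (nhdsWithin_le_nhds
    (isOpenEmbedding_coe.isOpen_range.mem_nhds ⟨UpperHalfPlane.I, rfl⟩))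
  rw [Set.empty_union, Set.compl_inter_self] at h3
  exact (NormedField.nhdsNE_neBot (UpperHalfPlane.I : ℂ)).ne (empty_mem_iff_bot.1 h3)

/-- A meromorphic function on `ℍ` that is not negligible has no zeros outside a closed discrete
set. -/
lemma eventually_ne_zero {f : ℍ → ℂ} (hf : IsMeromorphic f)
    (h : ¬ ∀ᶠ τ in codiscrete ℍ, f τ = 0) : ∀ᶠ τ in codiscrete ℍ, f τ ≠ 0 := by
  set F : ℂ → ℂ := fun z => f (ofComplex z) with hF
  have hFτ : ∀ τ : ℍ, F τ = f τ := fun τ => by simp [hF]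
  have hrange : Set.range ((↑) : ℍ → ℂ) = {z : ℂ | 0 < z.im} := UpperHalfPlane.range_coe
  have key : ∀ p : ℂ → Prop, (∀ᶠ τ : ℍ in codiscrete ℍ, p (F τ)) ↔
      ∀ᶠ z in codiscreteWithin {z : ℂ | 0 < z.im}, p (F z) := by
    intro p
    rw [Filter.Eventually, ← isOpenEmbedding_coe.isEmbedding.image_mem_codiscreteWithin_range,
      hrange]
    constructor
    · intro h1
      filter_upwards [h1] with z hz
      obtain ⟨τ, hτ, rfl⟩ := hz
      exact hτ
    · intro h1
      filter_upwards [h1, self_mem_codiscreteWithin _] with z hz hz'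
      exact ⟨⟨z, hz'⟩, hz, rfl⟩
  have hmer : MeromorphicOn F {z : ℂ | 0 < z.im} := fun z hz => hf ⟨z, hz⟩
  have hpre : IsPreconnected {z : ℂ | 0 < z.im} := (convex_halfSpace_im_gt 0).isPreconnected
  have goal : ∀ᶠ τ : ℍ in codiscrete ℍ, F τ ≠ 0 := by
    rw [key (fun w => w ≠ 0)]
    apply hmer.eventually_codiscreteWithin_apply_ne_zero
    intro x hx htop
    apply h
    have : ∀ᶠ τ : ℍ in codiscrete ℍ, F τ = 0 := by
      rw [key (fun w => w = 0), Filter.Eventually, mem_codiscreteWithin_iff_forall_mem_nhdsNE]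
      intro y hy
      have hy' : meromorphicOrderAt F y = ⊤ := by
        by_contra hne
        exact hmer.meromorphicOrderAt_ne_top_of_isPreconnected hpre hy hx hne htop
      filter_upwards [meromorphicOrderAt_eq_top_iff.1 hy'] with z hz
      exact Or.inl hz
    simpa only [hFτ] using this
  simpa only [hFτ] using goal

instance : negligibleIdeal.IsMaximal := by
  rw [Ideal.isMaximal_iff]
  refine ⟨fun h1 => ?_, fun J f hJ hf hfJ => ?_⟩
  · have := codiscrete_neBot
    obtain ⟨τ, hτ⟩ := Eventually.exists (f := codiscrete ℍ) h1
    exact one_ne_zero hτ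
  · have hne := eventually_ne_zero f.2 hf
    let g : meromorphicAlgebra := ⟨(f.1)⁻¹, fun τ => (f.2 τ).inv⟩
    have hmem : 1 - g * f ∈ negligibleIdeal := by
      change ∀ᶠ τ in codiscrete ℍ, 1 - (f.1 τ)⁻¹ * f.1 τ = 0
      filter_upwards [hne] with τ hτ
      rw [inv_mul_cancel₀ hτ, sub_self]
    have := J.add_mem (hJ hmem) (J.mul_mem_left g hfJ)
    simpa using this

/-- The field of meromorphic functions on the upper half plane: meromorphic functions `ℍ → ℂ`,
two of them being identified if they agree outside a closed discrete set. -/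
abbrev MeromorphicField : Type := meromorphicAlgebra ⧸ negligibleIdeal

instance : Field MeromorphicField := Ideal.Quotient.field negligibleIdeal

/-- The element of the field of meromorphic functions given by a meromorphic `f : ℍ → ℂ`. -/
def toField (f : ℍ → ℂ) (hf : IsMeromorphic f) : MeromorphicField :=
  Ideal.Quotient.mk negligibleIdeal ⟨f, hf⟩

/-! ### Modular functions -/

/-- `f (γ τ) = f τ` for all `γ ∈ Γ`, as an identity of meromorphic functions of `τ`. -/
def IsInvariant (Γ : Subgroup SL(2, ℤ)) (f : ℍ → ℂ) : Prop :=
  ∀ γ ∈ Γ, ∀ᶠ τ in codiscrete ℍ, f (γ • τ) = f τ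

/-- For each `γ ∈ SL(2, ℤ)`, the function `f (γ τ)` is, for `τ` with large imaginary part,
of the form `G (exp (2 π i τ / N))` with `G` meromorphic at `0` (as an identity of meromorphic
functions of `τ`, that is, up to a closed discrete set). -/
def IsMeromorphicAtCusps (N : ℕ) (f : ℍ → ℂ) : Prop :=
  ∀ γ : SL(2, ℤ), ∃ G : ℂ → ℂ, MeromorphicAt G 0 ∧
    ∀ᶠ τ : ℍ in codiscrete ℍ ⊓ atImInfty,
      f (γ • τ) = G (Complex.exp (2 * Real.pi * Complex.I * τ / N))

/-- The field of modular functions for a subgroup `Γ` of `SL(2, ℤ)` of level `N`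
(that is, containing `Γ(N)`), as a subfield of the field of meromorphic functions on `ℍ`. -/
def modularFunctionField (Γ : Subgroup SL(2, ℤ)) (N : ℕ) : IntermediateField ℂ MeromorphicField where
  carrier := {x | ∃ (f : ℍ → ℂ) (hf : IsMeromorphic f), toField f hf = x ∧
    IsInvariant Γ f ∧ IsMeromorphicAtCusps N f}
  mul_mem' := by
    rintro _ _ ⟨f, hf, rfl, hfi, hfc⟩ ⟨g, hg, rfl, hgi, hgc⟩
    refine ⟨f * g, fun τ => (hf τ).mul (hg τ), rfl, fun γ hγ => ?_, fun γ => ?_⟩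
    · filter_upwards [hfi γ hγ, hgi γ hγ] with τ h1 h2
      simp only [Pi.mul_apply, h1, h2]
    · obtain ⟨F, hF, h1⟩ := hfc γ
      obtain ⟨G, hG, h2⟩ := hgc γ
      refine ⟨F * G, hF.mul hG, ?_⟩
      filter_upwards [h1, h2] with τ h1 h2
      simp only [Pi.mul_apply, h1, h2]
  add_mem' := by
    rintro _ _ ⟨f, hf, rfl, hfi, hfc⟩ ⟨g, hg, rfl, hgi, hgc⟩
    refine ⟨f + g, fun τ => (hf τ).add (hg τ), rfl, fun γ hγ => ?_, fun γ => ?_⟩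
    · filter_upwards [hfi γ hγ, hgi γ hγ] with τ h1 h2
      simp only [Pi.add_apply, h1, h2]
    · obtain ⟨F, hF, h1⟩ := hfc γ
      obtain ⟨G, hG, h2⟩ := hgc γ
      refine ⟨F + G, hF.add hG, ?_⟩
      filter_upwards [h1, h2] with τ h1 h2
      simp only [Pi.add_apply, h1, h2]
  algebraMap_mem' := fun c =>
    ⟨fun _ => c, fun τ => MeromorphicAt.const c (τ : ℂ), rfl,
      fun _ _ => Eventually.of_forall fun _ => rfl,
      fun _ => ⟨fun _ => c, MeromorphicAt.const c 0, Eventually.of_forall fun _ => rfl⟩⟩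
  inv_mem' := by
    rintro _ ⟨f, hf, rfl, hfi, hfc⟩
    refine ⟨f⁻¹, fun τ => (hf τ).inv, ?_, fun γ hγ => ?_, fun γ => ?_⟩
    · by_cases h0 : ∀ᶠ τ in codiscrete ℍ, f τ = 0
      · have e1 : toField f hf = 0 := Ideal.Quotient.eq_zero_iff_mem.2 h0
        rw [e1, inv_zero]
        refine Ideal.Quotient.eq_zero_iff_mem.2 ?_
        change ∀ᶠ τ in codiscrete ℍ, (f τ)⁻¹ = 0
        filter_upwards [h0] with τ hτ
        rw [hτ, inv_zero]
      · refine eq_inv_of_mul_eq_one_left ?_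
        refine Ideal.Quotient.eq.2 ?_
        change ∀ᶠ τ in codiscrete ℍ, (f τ)⁻¹ * f τ - 1 = 0
        filter_upwards [eventually_ne_zero hf h0] with τ hτ
        rw [inv_mul_cancel₀ hτ, sub_self]
    · filter_upwards [hfi γ hγ] with τ h1
      simp only [Pi.inv_apply, h1]
    · obtain ⟨F, hF, h1⟩ := hfc γ
      refine ⟨F⁻¹, hF.inv, ?_⟩
      filter_upwards [h1] with τ h1
      simp only [Pi.inv_apply, h1]

/-! ### The functions `g₂`, `g₃`, `Δ`, `j`, `p_k`, `f_k` -/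

/-- The lattice `ℤ · 2πi + ℤ · 2πiτ`. -/
def periods (τ : ℍ) : PeriodPair where
  ω₁ := 2 * Real.pi * Complex.I
  ω₂ := 2 * Real.pi * Complex.I * τ
  indep := by
    rw [LinearIndependent.pair_iff]
    intro s t h
    have h2 : (2 * Real.pi * Complex.I : ℂ) ≠ 0 := Complex.two_pi_I_ne_zero
    have h3 : (s : ℂ) + t * (τ : ℂ) = 0 := by
      apply mul_left_cancel₀ h2
      rw [mul_zero, ← h, Complex.real_smul, Complex.real_smul]
      ring
    have him := congrArg Complex.im h3
    have ht : t = 0 := by simpa [τ.im_ne_zero] using him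
    subst ht
    exact ⟨by simpa using h3, rfl⟩

/-- `g₂ = (2πi)⁴ · 60 ∑' w⁻⁴`, the sum over the nonzero `w ∈ ℤ · 2πi + ℤ · 2πiτ`. -/
def g2 (τ : ℍ) : ℂ := (2 * Real.pi * Complex.I) ^ 4 * (periods τ).g₂

/-- `g₃ = (2πi)⁶ · 140 ∑' w⁻⁶`, the sum over the nonzero `w ∈ ℤ · 2πi + ℤ · 2πiτ`. -/
def g3 (τ : ℍ) : ℂ := (2 * Real.pi * Complex.I) ^ 6 * (periods τ).g₃

/-- The discriminant. -/
def Delta (τ : ℍ) : ℂ := g2 τ ^ 3 - 27 * g3 τ ^ 2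

/-- The `j`-invariant, in the normalization without the factor `1728`. -/
def jInv (τ : ℍ) : ℂ := g2 τ ^ 3 / Delta τ

/-- The value at the `N`-torsion point `2πik/N` of the Weierstrass `℘`-function of the lattice
`ℤ · 2πi + ℤ · 2πiτ`. -/
def pFun (N : ℕ) (k : ℤ) (τ : ℍ) : ℂ :=
  (periods τ).weierstrassP (2 * Real.pi * Complex.I * k / N)

/-- `f_k = g₂ g₃ p_k / Δ`. -/
def fFun (N : ℕ) (k : ℤ) (τ : ℍ) : ℂ := g2 τ * g3 τ * pFun N k τ / Delta τ

end ModularFunctions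

end

noncomputable section

namespace ModularFunctions

/-! ### Discrete exceptional sets and the action of `SL(2, ℤ)` -/

/-! The group `SL(2, ℤ)` acts on the field of meromorphic functions, and the proof is Galois theory
by interpolation, with no degree count. The functions `fricke N a b` = g₂ g₃ ℘(2πi(aτ + b)/N) / Δ
depend only on (a, b) mod N and are permuted by (a, b) ↦ (a, b)γ (`fricke_smul`). So h = f_k, which
has index (0, k), is a modular function for Γ₁(N) with a finite orbit. Let x be any modular function
for Γ₁(N). If the stabilizer of h fixes x, then g h ↦ g x is well defined on the orbit, and Lagrange
interpolation gives a polynomial P with P(h) = x and invariant coefficients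
(`exists_polynomial_of_stabilizer_le`). These coefficients are modular functions of level one, hence
lie in ℂ(j) (`mem_adjoin_jInv_of_smul_eq`), and x lies in ℂ(j, h).

The stabilizer of h is contained in ±Γ₁(N) (`mem_Gamma1_or_neg_mem`), and −1 acts trivially. This is
read off at i∞. Summing the ℘-series row by row with Σ 1/(z + n)² = (2πi)² q/(1 − q)² shows that the
torsion value of index (a, b) tends to 1/12 if N ∤ a, and to 1/12 + ζ/(1 − ζ)² with ζ = exp(2πib/N)
if N ∣ a (`tendsto_torsionP`). Since q/(1 − q)² has no zero at roots of unity q ≠ 1 and determines q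
up to inversion, the limits determine the index (0, k) up to sign.

For level one, compactness of the truncated fundamental domain gives a polynomial in j that kills
all poles in `ℍ`. A power of Δ then kills the pole at the cusp and leaves a modular form of weight
12n. Such a form is Δⁿ times a polynomial in j: subtract a multiple of E₄³ⁿ, divide the resulting
cusp form by Δ, and induct. -/

lemma eventually_codiscrete_iff {X : Type*} [TopologicalSpace X] {p : X → Prop} :
    (∀ᶠ x in codiscrete X, p x) ↔ ∀ x, ∀ᶠ y in 𝓝[≠] x, p y := by
  rw [Filter.Eventually, codiscrete, mem_codiscreteWithin_iff_forall_mem_nhdsNE]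
  simp [Filter.Eventually]

lemma map_coe_nhdsNE (τ : ℍ) : map ((↑) : ℍ → ℂ) (𝓝[≠] τ) = 𝓝[≠] (τ : ℂ) := by
  refine (isOpenEmbedding_coe.isEmbedding.map_nhdsWithin_eq _ _).trans ?_
  apply le_antisymm
  · refine nhdsWithin_mono _ ?_
    rintro _ ⟨x, hx, rfl⟩
    exact fun h => hx (UpperHalfPlane.ext h)
  · rw [← nhdsWithin_inter_of_mem' (mem_nhdsWithin_of_mem_nhds
      (isOpenEmbedding_coe.isOpen_range.mem_nhds ⟨τ, rfl⟩))]
    refine nhdsWithin_mono _ ?_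
    rintro _ ⟨hx, y, rfl⟩
    exact ⟨y, fun h => hx (congrArg _ h), rfl⟩

/-- Meromorphy is tested on punctured neighbourhoods in `ℂ`, exceptional sets on punctured
neighbourhoods in `ℍ`; this passes between the two. -/
lemma eventually_nhdsNE_coe_iff {τ : ℍ} {p : ℍ → Prop} :
    (∀ᶠ z in 𝓝[≠] (τ : ℂ), p (ofComplex z)) ↔ ∀ᶠ σ in 𝓝[≠] τ, p σ := by
  rw [← map_coe_nhdsNE, eventually_map]
  simp

lemma continuous_smul_SL (γ : SL(2, ℤ)) : Continuous fun τ : ℍ => γ • τ :=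
  continuous_const_smul (γ : GL (Fin 2) ℝ)

lemma tendsto_smul_nhdsNE (γ : SL(2, ℤ)) (τ : ℍ) :
    Tendsto (fun σ : ℍ => γ • σ) (𝓝[≠] τ) (𝓝[≠] (γ • τ)) :=
  tendsto_nhdsWithin_of_tendsto_nhds_of_eventually_within _
    ((continuous_smul_SL γ).tendsto τ |>.mono_left nhdsWithin_le_nhds)
    (by filter_upwards [self_mem_nhdsWithin] with σ hσ
        exact fun h => hσ (MulAction.injective γ h))

lemma tendsto_smul_codiscrete (γ : SL(2, ℤ)) :
    Tendsto (fun σ : ℍ => γ • σ) (codiscrete ℍ) (codiscrete ℍ) := by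
  intro s hs
  have hs' : ∀ᶠ x in codiscrete ℍ, x ∈ s := hs
  rw [eventually_codiscrete_iff] at hs'
  change ∀ᶠ x in codiscrete ℍ, γ • x ∈ s
  rw [eventually_codiscrete_iff]
  exact fun τ => (tendsto_smul_nhdsNE γ τ).eventually (hs' (γ • τ))

/-- The Möbius transformation attached to `γ`, as a function on `ℂ`. -/
def moebius (γ : SL(2, ℤ)) (z : ℂ) : ℂ :=
  ((γ 0 0 : ℤ) * z + (γ 0 1 : ℤ)) / ((γ 1 0 : ℤ) * z + (γ 1 1 : ℤ))

lemma coe_smul_eq (γ : SL(2, ℤ)) (τ : ℍ) : ((γ • τ : ℍ) : ℂ) = moebius γ τ := by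
  rw [coe_specialLinearGroup_apply]
  simp [moebius]

lemma denom_int_ne_zero (γ : SL(2, ℤ)) (τ : ℍ) :
    ((γ 1 0 : ℤ) : ℂ) * τ + ((γ 1 1 : ℤ) : ℂ) ≠ 0 := by
  rw [← ModularGroup.denom_apply]
  exact denom_ne_zero _ τ

lemma analyticAt_moebius (γ : SL(2, ℤ)) (τ : ℍ) : AnalyticAt ℂ (moebius γ) τ := by
  unfold moebius
  exact AnalyticAt.div (by fun_prop) (by fun_prop) (denom_int_ne_zero γ τ)

lemma eventually_ofComplex_moebius (γ : SL(2, ℤ)) (τ : ℍ) :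
    ∀ᶠ z in 𝓝 (τ : ℂ), ofComplex (moebius γ z) = γ • ofComplex z := by
  filter_upwards [isOpenEmbedding_coe.isOpen_range.mem_nhds ⟨τ, rfl⟩] with z hz
  obtain ⟨σ, rfl⟩ := hz
  rw [ofComplex_apply, ← coe_smul_eq, ofComplex_apply]

lemma IsMeromorphic.comp_smul {f : ℍ → ℂ} (hf : IsMeromorphic f) (γ : SL(2, ℤ)) :
    IsMeromorphic fun τ => f (γ • τ) := by
  intro τ
  have h1 := hf (γ • τ)
  rw [coe_smul_eq] at h1
  refine (h1.comp_analyticAt (analyticAt_moebius γ τ)).congr ?_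
  filter_upwards [(eventually_ofComplex_moebius γ τ).filter_mono nhdsWithin_le_nhds] with z hz
  simp [hz]

lemma toField_eq_iff {f g : ℍ → ℂ} {hf : IsMeromorphic f} {hg : IsMeromorphic g} :
    toField f hf = toField g hg ↔ ∀ᶠ τ in codiscrete ℍ, f τ = g τ := by
  refine Ideal.Quotient.eq.trans ?_
  change (∀ᶠ τ in codiscrete ℍ, f τ - g τ = 0) ↔ _
  simp only [sub_eq_zero]

lemma exists_toField_eq (x : MeromorphicField) : ∃ f hf, toField f hf = x := by
  obtain ⟨⟨f, hf⟩, rfl⟩ := Ideal.Quotient.mk_surjective x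
  exact ⟨f, hf, rfl⟩

/-- Composition with `τ ↦ γ • τ` on meromorphic functions. -/
def compRingHom (γ : SL(2, ℤ)) : meromorphicAlgebra →+* meromorphicAlgebra where
  toFun f := ⟨fun τ => f.1 (γ • τ), f.2.comp_smul γ⟩
  map_one' := rfl
  map_mul' _ _ := rfl
  map_zero' := rfl
  map_add' _ _ := rfl

/-- Composition with `τ ↦ γ • τ` on the field of meromorphic functions. -/
def compField (γ : SL(2, ℤ)) : MeromorphicField →+* MeromorphicField :=
  Ideal.quotientMap negligibleIdeal (compRingHom γ) fun _ hf =>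
    (tendsto_smul_codiscrete γ).eventually hf

lemma compField_toField (γ : SL(2, ℤ)) (f : ℍ → ℂ) (hf : IsMeromorphic f) :
    compField γ (toField f hf) = toField (fun τ => f (γ • τ)) (hf.comp_smul γ) := rfl

/-- Composition with γ is a right action; the inverse turns it into a left action. -/
instance : MulSemiringAction SL(2, ℤ) MeromorphicField where
  smul γ x := compField γ⁻¹ x
  one_smul x := by
    obtain ⟨f, hf, rfl⟩ := exists_toField_eq x
    change compField 1⁻¹ _ = _
    rw [compField_toField, toField_eq_iff]
    simp
  mul_smul γ δ x := by
    obtain ⟨f, hf, rfl⟩ := exists_toField_eq x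
    change compField (γ * δ)⁻¹ _ = compField γ⁻¹ (compField δ⁻¹ _)
    rw [compField_toField, compField_toField, compField_toField, toField_eq_iff]
    simp [mul_smul]
  smul_zero γ := (compField γ⁻¹).map_zero
  smul_add γ := (compField γ⁻¹).map_add
  smul_one γ := (compField γ⁻¹).map_one
  smul_mul γ := (compField γ⁻¹).map_mul

lemma smul_toField (γ : SL(2, ℤ)) (f : ℍ → ℂ) (hf : IsMeromorphic f) :
    γ • toField f hf = toField (fun τ => f (γ⁻¹ • τ)) (hf.comp_smul γ⁻¹) := rfl

lemma smul_toField_eq_self_iff {γ : SL(2, ℤ)} {f : ℍ → ℂ} {hf : IsMeromorphic f} :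
    γ • toField f hf = toField f hf ↔ ∀ᶠ τ in codiscrete ℍ, f (γ⁻¹ • τ) = f τ := by
  rw [smul_toField, toField_eq_iff]

/-! ### Interpolation on an orbit -/

open Polynomial in
/-- If `h` has a finite orbit and everything that fixes `h` fixes `f`, then `f` is a polynomial
in `h` with invariant coefficients. -/
theorem exists_polynomial_of_stabilizer_le {G L : Type*} [Group G] [Field L]
    [MulSemiringAction G L] (M : Subfield L) {h f : L} (hhM : ∀ g : G, g • h ∈ M)
    (hfM : ∀ g : G, g • f ∈ M) (hfin : (MulAction.orbit G h).Finite)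
    (hst : MulAction.stabilizer G h ≤ MulAction.stabilizer G f) :
    ∃ p : L[X], p.eval h = f ∧ ∀ n, p.coeff n ∈ M ∧ ∀ g : G, g • p.coeff n = p.coeff n := by
  classical
  -- The assignment g • h ↦ g • f is well defined: two elements with the same value on h differ by
  -- an element of the stabilizer of h, which also fixes f.
  have hval : ∀ y ∈ MulAction.orbit G h, ∃ z : L, ∀ g : G, g • h = y → z = g • f := by
    rintro _ ⟨g, rfl⟩
    refine ⟨g • f, fun g' hg' => ?_⟩
    have h1 : g⁻¹ * g' ∈ MulAction.stabilizer G h := by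
      rw [MulAction.mem_stabilizer_iff, mul_smul, hg']
      exact inv_smul_smul g h
    have h2 := MulAction.mem_stabilizer_iff.1 (hst h1)
    rw [mul_smul, inv_smul_eq_iff] at h2
    exact h2.symm
  choose! φ hφ using hval
  have hφ' : ∀ g : G, φ (g • h) = g • f := fun g => hφ _ ⟨g, rfl⟩ g rfl
  set s := hfin.toFinset with hs
  have hmem : ∀ y, y ∈ s ↔ ∃ g : G, g • h = y := fun y => by
    rw [hs, Set.Finite.mem_toFinset, MulAction.mem_orbit_iff]
  set p := Lagrange.interpolate s id φ with hp
  have hev : ∀ y ∈ s, p.eval y = φ y := fun y hy =>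
    Lagrange.eval_interpolate_at_node (v := id) φ (Set.injOn_id _) hy
  refine ⟨p, ?_, fun n => ⟨?_, fun g => ?_⟩⟩
  · rw [hev h ((hmem h).2 ⟨1, one_smul G h⟩)]
    simpa using hφ' 1
  -- Nodes and values lie in `M`, and the interpolation formula uses field operations only.
  · have hC : ∀ x ∈ M, C x ∈ (mapRingHom M.subtype).range := fun x hx => ⟨C ⟨x, hx⟩, by simp⟩
    have hX : (X : L[X]) ∈ (mapRingHom M.subtype).range := ⟨X, by simp⟩
    have hsM : ∀ y ∈ s, y ∈ M := fun y hy => by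
      obtain ⟨g, rfl⟩ := (hmem y).1 hy
      exact hhM g
    have hlift : p ∈ (mapRingHom M.subtype).range := by
      rw [hp, Lagrange.interpolate_apply]
      refine sum_mem fun y hy => mul_mem (hC _ ?_) (prod_mem fun y' hy' => ?_)
      · obtain ⟨g, rfl⟩ := (hmem y).1 hy
        rw [hφ']
        exact hfM g
      · have hy'' := hsM y' (Finset.mem_of_mem_erase hy')
        exact mul_mem (hC _ (inv_mem (sub_mem (hsM y hy) hy''))) (sub_mem hX (hC _ hy''))
    obtain ⟨q, hq⟩ := hlift
    rw [← hq, coe_mapRingHom, coeff_map]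
    exact (q.coeff n).2
  -- g permutes the nodes and φ is equivariant, so applying g to the coefficients gives a solution
  -- of the same interpolation problem; uniqueness concludes.
  · have hmap : p.map (MulSemiringAction.toRingHom G L g) = p := by
      refine Lagrange.eq_interpolate_of_eval_eq (v := id) φ (Set.injOn_id _) ?_ fun y hy => ?_
      · exact (Polynomial.degree_map_le).trans_lt
          (Lagrange.degree_interpolate_lt φ (Set.injOn_id _))
      · obtain ⟨g', rfl⟩ := (hmem y).1 hy
        have h1 : g' • h = MulSemiringAction.toRingHom G L g ((g⁻¹ * g') • h) := by
          rw [MulSemiringAction.toRingHom_apply, smul_smul, mul_inv_cancel_left]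
        rw [id, h1, Polynomial.eval_map_apply, hev _ ((hmem _).2 ⟨_, rfl⟩), ← h1, hφ', hφ',
          MulSemiringAction.toRingHom_apply, smul_smul, mul_inv_cancel_left]
    conv_rhs => rw [← hmap]
    rw [Polynomial.coeff_map, MulSemiringAction.toRingHom_apply]

end ModularFunctions

namespace ModularFunctions

open EisensteinSeries ModularForm
open scoped Manifold

/-! ### `g₂`, `g₃`, `Δ` and `j` in terms of Eisenstein series -/

lemma coe_latticeEquivProd_symm (τ : ℍ) (m n : ℤ) :
    (((periods τ).latticeEquivProd.symm (n, m) : (periods τ).lattice) : ℂ) =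
      2 * Real.pi * Complex.I * (m * τ + n) := by
  rw [PeriodPair.latticeEquiv_symm_apply]
  simp only [periods]
  ring

/-- The power of 2πi cancels the scaling of the lattice, leaving the sum over ℤ · 1 + ℤ · τ. -/
lemma two_pi_I_pow_mul_G (τ : ℍ) {n : ℕ} (hn : 3 ≤ n) :
    (2 * Real.pi * Complex.I) ^ n * (periods τ).G n = 2 * riemannZeta n * E hn τ := by
  have h1 : ∑' v : Fin 2 → ℤ, eisSummand n v τ =
      (2 * Real.pi * Complex.I) ^ n * (periods τ).G n := by
    rw [PeriodPair.G, ← tsum_mul_left, ← ((Equiv.prodComm ℤ ℤ).trans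
      (periods τ).latticeEquivProd.symm.toEquiv).tsum_eq, ← (finTwoArrowEquiv ℤ).tsum_eq]
    refine tsum_congr fun v => ?_
    have h2 : ((2 * Real.pi * Complex.I : ℂ)) ^ n ≠ 0 := pow_ne_zero _ Complex.two_pi_I_ne_zero
    change ((v 0 : ℂ) * τ + v 1) ^ (-(n : ℤ)) = (2 * Real.pi * Complex.I) ^ n *
      (((((periods τ).latticeEquivProd.symm (v 1, v 0) : (periods τ).lattice)) : ℂ) ^ n)⁻¹
    rw [coe_latticeEquivProd_symm, zpow_neg, zpow_natCast, mul_pow (2 * Real.pi * Complex.I : ℂ)]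
    rw [mul_inv, mul_inv_cancel_left₀ h2]
  rw [← h1, tsum_eisSummand_eq_riemannZeta_mul_eisensteinSeries hn,
    show E hn τ = (1 / 2 : ℂ) • eisensteinSeriesSIF (N := 1) 0 n τ from rfl,
    eisensteinSeriesSIF_apply 0 n τ, smul_eq_mul]
  ring

lemma g2_eq (τ : ℍ) : g2 τ = 4 * Real.pi ^ 4 / 3 * E₄ τ := by
  rw [g2, PeriodPair.g₂, mul_left_comm, two_pi_I_pow_mul_G τ (by norm_num)]
  have : riemannZeta (4 : ℕ) = (Real.pi : ℂ) ^ 4 / 90 := by exact_mod_cast riemannZeta_four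
  rw [this]
  ring

lemma riemannZeta_six : riemannZeta (6 : ℕ) = (Real.pi : ℂ) ^ 6 / 945 := by
  have h := riemannZeta_two_mul_nat (k := 3) (by norm_num)
  have hb : bernoulli 6 = 1 / 42 := by decide +kernel
  norm_num [hb, Nat.factorial] at h
  push_cast
  rw [h]
  ring

lemma g3_eq (τ : ℍ) : g3 τ = 8 * Real.pi ^ 6 / 27 * E₆ τ := by
  rw [g3, PeriodPair.g₃, mul_left_comm, two_pi_I_pow_mul_G τ (by norm_num), riemannZeta_six]
  ring

/-- The factors 60 · 2ζ(4) = 4π⁴/3 and 140 · 2ζ(6) = 8π⁶/27 satisfy (4/3)³ = 27 · (8/27)² = 64/27,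
and 64/27 · 1728 = 2¹². -/
lemma Delta_eq (τ : ℍ) : Delta τ = (2 * Real.pi) ^ 12 * discriminant τ := by
  rw [Delta, g2_eq, g3_eq, discriminant_eq_E₄_cube_sub_E₆_sq]
  ring

lemma Delta_ne_zero (τ : ℍ) : Delta τ ≠ 0 := by
  rw [Delta_eq]
  exact mul_ne_zero (by norm_num [Real.pi_ne_zero]) (discriminant_ne_zero τ)

lemma jInv_eq (τ : ℍ) : jInv τ = 1 / 1728 * (E₄ τ ^ 3 / discriminant τ) := by
  have h1 : (Real.pi : ℂ) ≠ 0 := by exact_mod_cast Real.pi_ne_zero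
  have h2 := discriminant_ne_zero τ
  rw [jInv, Delta_eq, g2_eq]
  field_simp
  ring

lemma isMeromorphic_of_mdifferentiable {f : ℍ → ℂ} (hf : MDiff f) : IsMeromorphic f := fun τ =>
  ((UpperHalfPlane.mdifferentiable_iff.1 hf).analyticAt
    (isOpen_upperHalfPlaneSet.mem_nhds τ.2)).meromorphicAt

lemma mdifferentiable_E₄ : MDiff (E₄ : ℍ → ℂ) := E₄.holo'

lemma mdifferentiable_E₆ : MDiff (E₆ : ℍ → ℂ) := E₆.holo'

lemma mdifferentiable_discriminant : MDiff discriminant := CuspForm.discriminant.holo'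

lemma mdifferentiable_g2 : MDiff g2 := by
  rw [show g2 = fun τ => 4 * (Real.pi : ℂ) ^ 4 / 3 * E₄ τ from funext g2_eq]
  exact mdifferentiable_const.mul mdifferentiable_E₄

lemma mdifferentiable_g3 : MDiff g3 := by
  rw [show g3 = fun τ => 8 * (Real.pi : ℂ) ^ 6 / 27 * E₆ τ from funext g3_eq]
  exact mdifferentiable_const.mul mdifferentiable_E₆

lemma mdifferentiable_Delta : MDiff Delta := by
  rw [show Delta = fun τ => (2 * (Real.pi : ℂ)) ^ 12 * discriminant τ from funext Delta_eq]
  exact mdifferentiable_const.mul mdifferentiable_discriminant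

lemma mdifferentiable_jInv : MDiff jInv := by
  rw [UpperHalfPlane.mdifferentiable_iff]
  exact ((UpperHalfPlane.mdifferentiable_iff.1 mdifferentiable_g2).pow 3).div
    (UpperHalfPlane.mdifferentiable_iff.1 mdifferentiable_Delta) fun z _ => Delta_ne_zero _

lemma modularForm_smul {k : ℤ} (f : ModularForm 𝒮ℒ k) (γ : SL(2, ℤ)) (τ : ℍ) :
    f (γ • τ) = (((γ 1 0 : ℤ) : ℂ) * τ + (γ 1 1 : ℤ)) ^ k * f τ := by
  have : SlashInvariantFormClass (ModularForm 𝒮ℒ k) (CongruenceSubgroup.Gamma 1) k :=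
    CongruenceSubgroup.Gamma_one_coe_eq_SL ▸ inferInstance
  rw [SlashInvariantForm.slash_action_eqn_SL'' f (CongruenceSubgroup.mem_Gamma_one γ),
    ModularGroup.denom_apply]

lemma discriminant_smul (γ : SL(2, ℤ)) (τ : ℍ) :
    discriminant (γ • τ) = (((γ 1 0 : ℤ) : ℂ) * τ + (γ 1 1 : ℤ)) ^ (12 : ℤ) * discriminant τ := by
  have : SlashInvariantFormClass (CuspForm 𝒮ℒ 12) (CongruenceSubgroup.Gamma 1) 12 :=
    CongruenceSubgroup.Gamma_one_coe_eq_SL ▸ inferInstance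
  rw [← CuspForm.coe_discriminant,
    SlashInvariantForm.slash_action_eqn_SL'' _ (CongruenceSubgroup.mem_Gamma_one γ),
    ModularGroup.denom_apply]

lemma g2_smul (γ : SL(2, ℤ)) (τ : ℍ) :
    g2 (γ • τ) = (((γ 1 0 : ℤ) : ℂ) * τ + (γ 1 1 : ℤ)) ^ 4 * g2 τ := by
  rw [g2_eq, g2_eq, modularForm_smul]
  norm_cast
  ring

lemma g3_smul (γ : SL(2, ℤ)) (τ : ℍ) :
    g3 (γ • τ) = (((γ 1 0 : ℤ) : ℂ) * τ + (γ 1 1 : ℤ)) ^ 6 * g3 τ := by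
  rw [g3_eq, g3_eq, modularForm_smul]
  norm_cast
  ring

lemma Delta_smul (γ : SL(2, ℤ)) (τ : ℍ) :
    Delta (γ • τ) = (((γ 1 0 : ℤ) : ℂ) * τ + (γ 1 1 : ℤ)) ^ 12 * Delta τ := by
  rw [Delta, Delta, g2_smul, g3_smul]
  ring

lemma jInv_smul (γ : SL(2, ℤ)) (τ : ℍ) : jInv (γ • τ) = jInv τ := by
  rw [jInv, jInv, g2_smul, Delta_smul, mul_pow, ← pow_mul]
  exact mul_div_mul_left _ _ (pow_ne_zero _ (denom_int_ne_zero γ τ))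

end ModularFunctions

namespace ModularFunctions

open EisensteinSeries ModularForm
open scoped Manifold

/-! ### Modular functions of level one -/

instance nhdsNE_neBot (τ : ℍ) : (𝓝[≠] τ).NeBot := by
  have h : (map ((↑) : ℍ → ℂ) (𝓝[≠] τ)).NeBot := by
    rw [map_coe_nhdsNE]
    infer_instance
  exact map_neBot_iff _ |>.1 h

/-- `f` agrees near `τ`, except possibly at `τ`, with a function analytic at `τ`. -/
def IsRegularAt (f : ℍ → ℂ) (τ : ℍ) : Prop :=
  ∃ h : ℂ → ℂ, AnalyticAt ℂ h τ ∧ ∀ᶠ z in 𝓝[≠] (τ : ℂ), f (ofComplex z) = h z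

lemma isRegularAt_of_order_nonneg {f : ℍ → ℂ} (hf : IsMeromorphic f) {τ : ℍ}
    (h : 0 ≤ meromorphicOrderAt (fun z => f (ofComplex z)) τ) : IsRegularAt f τ := by
  have hnf := (hf τ).eq_nhdsNE_toMeromorphicNFAt
  refine ⟨_, (meromorphicNFAt_toMeromorphicNFAt).meromorphicOrderAt_nonneg_iff_analyticAt.1 ?_, hnf⟩
  rwa [← meromorphicOrderAt_congr hnf]

lemma IsRegularAt.congr {f g : ℍ → ℂ} {τ : ℍ} (hf : IsRegularAt f τ)
    (h : ∀ᶠ σ in 𝓝[≠] τ, g σ = f σ) : IsRegularAt g τ := by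
  obtain ⟨F, hF, h1⟩ := hf
  refine ⟨F, hF, ?_⟩
  filter_upwards [h1, eventually_nhdsNE_coe_iff.2 h] with z h2 h3
  rw [h3, h2]

lemma IsRegularAt.mul {f g : ℍ → ℂ} {τ : ℍ} (hf : IsRegularAt f τ) (hg : IsRegularAt g τ) :
    IsRegularAt (fun σ => f σ * g σ) τ := by
  obtain ⟨F, hF, h1⟩ := hf
  obtain ⟨G, hG, h2⟩ := hg
  refine ⟨F * G, hF.mul hG, ?_⟩
  filter_upwards [h1, h2] with z h1 h2
  simp [h1, h2]

lemma IsRegularAt.comp_smul {f : ℍ → ℂ} {γ : SL(2, ℤ)} {τ : ℍ} (hf : IsRegularAt f (γ • τ)) :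
    IsRegularAt (fun σ => f (γ • σ)) τ := by
  obtain ⟨F, hF, h1⟩ := hf
  rw [coe_smul_eq] at hF
  refine ⟨F ∘ moebius γ, hF.comp (analyticAt_moebius γ τ), ?_⟩
  have h2 : ∀ᶠ σ in 𝓝[≠] (γ • τ), f σ = F σ := by
    rw [← map_coe_nhdsNE, eventually_map] at h1
    simpa using h1
  have h3 := eventually_nhdsNE_coe_iff.2 ((tendsto_smul_nhdsNE γ τ).eventually h2)
  filter_upwards [h3, (eventually_ofComplex_moebius γ τ).filter_mono nhdsWithin_le_nhds,
    mem_nhdsWithin_of_mem_nhds (isOpenEmbedding_coe.isOpen_range.mem_nhds ⟨τ, rfl⟩)] with z h4 h5 h6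
  obtain ⟨σ, rfl⟩ := h6
  rw [h4, Function.comp, coe_smul_eq, ofComplex_apply]

lemma isRegularAt_of_mdifferentiable {f : ℍ → ℂ} (hf : MDiff f) (τ : ℍ) : IsRegularAt f τ :=
  ⟨_, (UpperHalfPlane.mdifferentiable_iff.1 hf).analyticAt
    (isOpen_upperHalfPlaneSet.mem_nhds τ.2), Eventually.of_forall fun _ => rfl⟩

/-- A function that is regular at every point agrees with a holomorphic function outside a
discrete set. -/
lemma exists_mdifferentiable {f : ℍ → ℂ} (hf : ∀ τ, IsRegularAt f τ) :
    ∃ g : ℍ → ℂ, MDiff g ∧ ∀ᶠ τ in codiscrete ℍ, f τ = g τ := by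
  choose F hF h1 using hf
  -- Near τ the diagonal σ ↦ F σ σ coincides with F τ: both F σ and F τ are continuous at σ and
  -- agree with f on a punctured neighbourhood of σ. Hence the diagonal is holomorphic.
  have key : ∀ τ : ℍ, ∀ᶠ z in 𝓝 (τ : ℂ), F (ofComplex z) z = F τ z := by
    intro τ
    have h2 : ∀ᶠ z in 𝓝[≠] (τ : ℂ), F (ofComplex z) z = F τ z := by
      filter_upwards [eventually_eventually_nhdsWithin.2 (h1 τ),
        (hF τ).eventually_analyticAt.filter_mono nhdsWithin_le_nhds, self_mem_nhdsWithin,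
        mem_nhdsWithin_of_mem_nhds (isOpenEmbedding_coe.isOpen_range.mem_nhds ⟨τ, rfl⟩)]
        with z h3 h4 h5 h6
      obtain ⟨σ, rfl⟩ := h6
      rw [ofComplex_apply]
      have h7 : F σ =ᶠ[𝓝[≠] (σ : ℂ)] F τ := by
        rw [isOpen_compl_singleton.nhdsWithin_eq h5] at h3
        filter_upwards [h1 σ, h3.filter_mono nhdsWithin_le_nhds] with w hw1 hw2
        rw [← hw1, hw2]
      exact (((hF σ).continuousAt.eventuallyEq_nhds_iff_eventuallyEq_nhdsNE
        h4.continuousAt).1 h7).eq_of_nhds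
    have h3 := eventually_nhdsWithin_iff.1 h2
    filter_upwards [h3] with z hz
    by_cases hzτ : z = τ
    · rw [hzτ, ofComplex_apply]
    · exact hz hzτ
  refine ⟨fun τ => F τ τ, ?_, ?_⟩
  · rw [UpperHalfPlane.mdifferentiable_iff]
    intro z hz
    refine (DifferentiableAt.congr_of_eventuallyEq (hF ⟨z, hz⟩).differentiableAt
      ?_).differentiableWithinAt
    filter_upwards [key ⟨z, hz⟩, isOpen_upperHalfPlaneSet.mem_nhds hz] with w hw1 hw2
    rw [← hw1, Function.comp, ofComplex_apply_of_im_pos hw2]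
  · rw [eventually_codiscrete_iff]
    intro τ
    rw [← eventually_nhdsNE_coe_iff]
    filter_upwards [h1 τ, (key τ).filter_mono nhdsWithin_le_nhds,
      mem_nhdsWithin_of_mem_nhds (isOpenEmbedding_coe.isOpen_range.mem_nhds ⟨τ, rfl⟩)]
      with z h2 h3 h4
    obtain ⟨σ, rfl⟩ := h4
    rw [h2, ← h3, ofComplex_apply]

lemma eq_of_eventually_codiscrete {f g : ℍ → ℂ} (hf : Continuous f) (hg : Continuous g)
    (h : ∀ᶠ τ in codiscrete ℍ, f τ = g τ) : f = g := by
  funext τ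
  exact ((hf.continuousAt.eventuallyEq_nhds_iff_eventuallyEq_nhdsNE hg.continuousAt).1
    (eventually_codiscrete_iff.1 h τ)).eq_of_nhds

/-- Exceptional points may accumulate towards i∞, so no height clears them all; punctured
neighbourhoods above a fixed height are what remains available. -/
lemma exists_of_eventually_codiscrete_inf_atImInfty {p : ℍ → Prop}
    (h : ∀ᶠ τ in codiscrete ℍ ⊓ atImInfty, p τ) :
    ∃ A : ℝ, ∀ τ : ℍ, A < τ.im → ∀ᶠ σ in 𝓝[≠] τ, p σ := by
  rw [Filter.Eventually, mem_inf_iff] at h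
  obtain ⟨s, hs, t, ht, hst⟩ := h
  obtain ⟨A, hA⟩ := (atImInfty_mem t).1 ht
  refine ⟨A, fun τ hτ => ?_⟩
  have hs' : ∀ᶠ σ in codiscrete ℍ, σ ∈ s := hs
  filter_upwards [eventually_codiscrete_iff.1 hs' τ, mem_nhdsWithin_of_mem_nhds
    (UpperHalfPlane.continuous_im.continuousAt.eventually_const_lt hτ)] with σ h1 h2
  have : σ ∈ s ∩ t := ⟨h1, hA σ h2.le⟩
  rwa [← hst] at this

lemma isBoundedAtImInfty_of_isBigO {f : ℍ → ℂ} (hf : Continuous f)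
    (h : f =O[codiscrete ℍ ⊓ atImInfty] (1 : ℍ → ℝ)) : IsBoundedAtImInfty f := by
  obtain ⟨C, hC⟩ := h.bound
  obtain ⟨A, hA⟩ := exists_of_eventually_codiscrete_inf_atImInfty hC
  rw [UpperHalfPlane.isBoundedAtImInfty_iff]
  refine ⟨C, A + 1, fun τ hτ => ?_⟩
  refine le_of_tendsto (hf.norm.continuousAt.tendsto.mono_left (nhdsWithin_le_nhds (s := {τ}ᶜ))) ?_
  filter_upwards [hA τ (by linarith)] with σ hσ
  simpa using hσ

/-- The local parameter at the cusp `i∞` for the level `N`. -/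
lemma tendsto_qParam_atImInfty {N : ℕ} (hN : 0 < N) :
    Tendsto (fun τ : ℍ => Complex.exp (2 * Real.pi * Complex.I * τ / N)) atImInfty (𝓝[≠] 0) := by
  have h := (Function.Periodic.qParam_tendsto (h := (N : ℝ)) (by exact_mod_cast hN)).comp
    tendsto_coe_atImInfty
  refine h.congr fun τ => ?_
  simp [Function.Periodic.qParam]

/-- A function meromorphic at 0 is analytic on a punctured disc, so f has no poles above some
height. -/
lemma isRegularAt_of_im_large {N : ℕ} (hN : 0 < N) {f : ℍ → ℂ} {G : ℂ → ℂ}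
    (hG : MeromorphicAt G 0) (h : ∀ᶠ τ : ℍ in codiscrete ℍ ⊓ atImInfty,
      f τ = G (Complex.exp (2 * Real.pi * Complex.I * τ / N))) :
    ∃ A : ℝ, ∀ τ : ℍ, A < τ.im → IsRegularAt f τ := by
  obtain ⟨A, hA⟩ := exists_of_eventually_codiscrete_inf_atImInfty h
  obtain ⟨B, hB⟩ := (atImInfty_mem _).1
    ((tendsto_qParam_atImInfty hN).eventually hG.eventually_analyticAt)
  refine ⟨max A B, fun τ hτ => ⟨fun z => G (Complex.exp (2 * Real.pi * Complex.I * z / N)), ?_, ?_⟩⟩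
  · exact AnalyticAt.fun_comp (g := G) (hB τ ((le_max_right A B).trans hτ.le)) (by fun_prop)
  · have h1 := hA τ ((le_max_left A B).trans_lt hτ)
    rw [← map_coe_nhdsNE, eventually_map]
    simpa using h1

lemma meromorphicOrderAt_jInv_sub_pos (τ : ℍ) :
    1 ≤ meromorphicOrderAt (fun z => jInv (ofComplex z) - jInv τ) (τ : ℂ) := by
  have h1 : AnalyticAt ℂ (fun z => jInv (ofComplex z) - jInv τ) (τ : ℂ) :=
    ((UpperHalfPlane.mdifferentiable_iff.1 mdifferentiable_jInv).analyticAt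
      (isOpen_upperHalfPlaneSet.mem_nhds τ.2)).sub analyticAt_const
  have h2 : analyticOrderAt (fun z => jInv (ofComplex z) - jInv τ) (τ : ℂ) ≠ 0 :=
    analyticOrderAt_ne_zero.2 ⟨h1, by simp⟩
  rw [h1.meromorphicOrderAt_eq]
  cases h3 : analyticOrderAt (fun z => jInv (ofComplex z) - jInv τ) (τ : ℂ) with
  | top => simp
  | coe n =>
    rw [h3] at h2
    have h4 : 1 ≤ n := Nat.one_le_iff_ne_zero.2 (by exact_mod_cast h2)
    change ((1 : ℤ) : WithTop ℤ) ≤ ((n : ℤ) : WithTop ℤ)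
    exact_mod_cast h4

/-- Arithmetic of the order of (j − j(τ))ⁿ f, where a and b are the orders of the two factors.
Infinite orders are allowed, so nonconstancy of j plays no role here. -/
lemma exists_nat_mul_add_nonneg {a : WithTop ℤ} (b : WithTop ℤ) (ha : 1 ≤ a) :
    ∃ n : ℕ, 0 ≤ (n : WithTop ℤ) * a + b := by
  induction b with
  | top => exact ⟨0, by simp⟩
  | coe b =>
    induction a with
    | top =>
      refine ⟨1, ?_⟩
      rw [Nat.cast_one, one_mul, WithTop.top_add]
      exact le_top
    | coe a =>
      have ha' : 1 ≤ a := by exact_mod_cast ha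
      refine ⟨b.natAbs, ?_⟩
      have h : 0 ≤ (b.natAbs : ℤ) * a + b := by
        have h1 : (b.natAbs : ℤ) * 1 ≤ b.natAbs * a := by gcongr
        have h2 : -b ≤ b.natAbs := by omega
        linarith
      change ((0 : ℤ) : WithTop ℤ) ≤ (((b.natAbs : ℤ) * a + b : ℤ) : WithTop ℤ)
      exact WithTop.coe_le_coe.2 h

/-- A power of `j - j(τ)` kills the pole of a meromorphic function at `τ`. -/
lemma exists_isRegularAt_pow_mul {f : ℍ → ℂ} (hf : IsMeromorphic f) (τ : ℍ) :
    ∃ n : ℕ, ∀ᶠ σ in 𝓝 τ, IsRegularAt (fun ρ => (jInv ρ - jInv τ) ^ n * f ρ) σ := by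
  have hj : MDiff fun ρ => jInv ρ - jInv τ := mdifferentiable_jInv.sub mdifferentiable_const
  have hjm := isMeromorphic_of_mdifferentiable hj
  obtain ⟨n, hn⟩ : ∃ n : ℕ, 0 ≤ meromorphicOrderAt
      (fun z => (jInv (ofComplex z) - jInv τ) ^ n * f (ofComplex z)) (τ : ℂ) := by
    have hmul : ∀ n : ℕ, meromorphicOrderAt
        (fun z => (jInv (ofComplex z) - jInv τ) ^ n * f (ofComplex z)) (τ : ℂ) =
        n * meromorphicOrderAt (fun z => jInv (ofComplex z) - jInv τ) (τ : ℂ) +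
          meromorphicOrderAt (fun z => f (ofComplex z)) τ := fun n => by
      rw [← meromorphicOrderAt_pow (hjm τ), ← meromorphicOrderAt_mul ((hjm τ).pow n) (hf τ)]
      rfl
    simp only [hmul]
    exact exists_nat_mul_add_nonneg _ (meromorphicOrderAt_jInv_sub_pos τ)
  refine ⟨n, ?_⟩
  have h1 : IsMeromorphic fun ρ => (jInv ρ - jInv τ) ^ n * f ρ := fun ρ =>
    ((hjm ρ).pow n).mul (hf ρ)
  have h2 := isRegularAt_of_order_nonneg h1 hn
  -- Meromorphy at τ gives analyticity nearby, so regularity holds on a full neighbourhood; the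
  -- compactness argument needs this.
  have h3 : ∀ᶠ σ in 𝓝[≠] τ, IsRegularAt (fun ρ => (jInv ρ - jInv τ) ^ n * f ρ) σ := by
    have h4 := (h1 τ).eventually_analyticAt
    rw [← map_coe_nhdsNE, eventually_map] at h4
    filter_upwards [h4] with σ hσ using ⟨_, hσ, Eventually.of_forall fun _ => rfl⟩
  filter_upwards [eventually_nhdsWithin_iff.1 h3] with σ hσ
  by_cases hστ : σ = τ
  · rwa [hστ]
  · exact hσ hστ

end ModularFunctions

namespace ModularFunctions

open EisensteinSeries ModularForm
open scoped Manifold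

/-! ### ### Polynomials in `j` and removal of poles -/

lemma isMeromorphic_jInv : IsMeromorphic jInv :=
  isMeromorphic_of_mdifferentiable mdifferentiable_jInv

lemma mdifferentiable_eval_jInv (p : Polynomial ℂ) : MDiff fun τ => p.eval (jInv τ) := by
  rw [UpperHalfPlane.mdifferentiable_iff]
  exact p.differentiable.comp_differentiableOn
    (UpperHalfPlane.mdifferentiable_iff.1 mdifferentiable_jInv)

lemma aeval_toField_jInv (p : Polynomial ℂ) :
    Polynomial.aeval (toField jInv isMeromorphic_jInv) p =
      toField (fun τ => p.eval (jInv τ))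
        (isMeromorphic_of_mdifferentiable (mdifferentiable_eval_jInv p)) := by
  have h1 : ((Polynomial.aeval (⟨jInv, isMeromorphic_jInv⟩ : meromorphicAlgebra) p :
      meromorphicAlgebra) : ℍ → ℂ) = fun τ => p.eval (jInv τ) := by
    funext τ
    have h := Polynomial.aeval_algHom_apply ((Pi.evalAlgHom ℂ (fun _ : ℍ => ℂ) τ).comp
      meromorphicAlgebra.val) (⟨jInv, isMeromorphic_jInv⟩ : meromorphicAlgebra) p
    refine h.symm.trans ?_
    rw [Polynomial.coe_aeval_eq_eval]
    rfl
  have h2 := Polynomial.aeval_algHom_apply (Ideal.Quotient.mkₐ ℂ negligibleIdeal)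
    (⟨jInv, isMeromorphic_jInv⟩ : meromorphicAlgebra) p
  refine Eq.trans h2 ?_
  exact congrArg _ (Subtype.ext h1)

/-- Otherwise E₄³ would be a multiple of the cusp form Δ, while its constant term is 1. -/
lemma jInv_not_const (c : ℂ) : ∃ τ, jInv τ ≠ c := by
  by_contra! h
  have h1 : (E₄.pow 3 : ℍ → ℂ) = (1728 * c) • (CuspForm.discriminant : ℍ → ℂ) := by
    funext τ
    have h2 := h τ
    rw [jInv_eq] at h2
    have h3 := discriminant_ne_zero τ
    field_simp at h2
    simp only [coe_pow, Pi.pow_apply, Pi.smul_apply, CuspForm.coe_discriminant, smul_eq_mul, h2]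
    ring
  have h2 := congrArg (fun f => (qExpansion 1 f).coeff 0) h1
  rw [ModularForm.qExpansion_pow one_pos one_mem_strictPeriods_SL,
    ModularForm.qExpansion_smul one_pos one_mem_strictPeriods_SL,
    PowerSeries.coeff_smul, CuspFormClass.qExpansion_coeff_zero _ one_pos one_mem_strictPeriods_SL,
    PowerSeries.coeff_zero_eq_constantCoeff, map_pow,
    ← PowerSeries.coeff_zero_eq_constantCoeff_apply, E_qExpansion_coeff_zero _ ⟨2, rfl⟩] at h2
  simp at h2

/-- As `ℂ` is algebraically closed, an algebraic j would be constant. -/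
lemma aeval_toField_jInv_ne_zero {p : Polynomial ℂ} (hp : p ≠ 0) :
    Polynomial.aeval (toField jInv isMeromorphic_jInv) p ≠ 0 := by
  intro h0
  obtain ⟨c, hc⟩ : ∃ c : ℂ, toField jInv isMeromorphic_jInv = algebraMap ℂ _ c := by
    have h1 : IsAlgebraic ℂ (toField jInv isMeromorphic_jInv) := ⟨p, hp, h0⟩
    obtain ⟨c, hc⟩ := minpoly.mem_range_of_degree_eq_one ℂ _
      (IsAlgClosed.degree_eq_one_of_irreducible ℂ (minpoly.irreducible h1.isIntegral))
    exact ⟨c, hc.symm⟩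
  obtain ⟨τ, hτ⟩ := jInv_not_const c
  have h2 : ∀ᶠ τ in codiscrete ℍ, jInv τ = c :=
    toField_eq_iff (hg := fun τ => MeromorphicAt.const c (τ : ℂ)).1 hc
  exact hτ (congrFun (eq_of_eventually_codiscrete mdifferentiable_jInv.continuous
    continuous_const h2) τ)

/-- Multiplication by a polynomial in `j` kills all the poles in `ℍ` of a modular function of
level one. -/
lemma exists_polynomial_isRegularAt {N : ℕ} (hN : 0 < N) {f : ℍ → ℂ} (hf : IsMeromorphic f)
    (hinv : IsInvariant ⊤ f) {G : ℂ → ℂ} (hG : MeromorphicAt G 0)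
    (h : ∀ᶠ τ : ℍ in codiscrete ℍ ⊓ atImInfty,
      f τ = G (Complex.exp (2 * Real.pi * Complex.I * τ / N))) :
    ∃ p : Polynomial ℂ, p ≠ 0 ∧ ∀ τ, IsRegularAt (fun τ => p.eval (jInv τ) * f τ) τ := by
  classical
  obtain ⟨A, hA⟩ := isRegularAt_of_im_large hN hG h
  choose n hn using exists_isRegularAt_pow_mul hf
  -- Only the part of the fundamental domain of height at most `A` can contain poles, and it is
  -- compact; finitely many factors (X − j(s))ⁿ therefore suffice.
  obtain ⟨t, -, ht⟩ := (ModularGroup.isCompact_truncatedFundamentalDomain A).elim_nhds_subcover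
    (fun τ => {σ | IsRegularAt (fun ρ => (jInv ρ - jInv τ) ^ n τ * f ρ) σ}) (fun τ _ => hn τ)
  set p : Polynomial ℂ := ∏ s ∈ t, (Polynomial.X - Polynomial.C (jInv s)) ^ n s with hp
  have hreg : ∀ q : Polynomial ℂ, ∀ τ, IsRegularAt (fun σ => q.eval (jInv σ)) τ := fun q τ =>
    isRegularAt_of_mdifferentiable (mdifferentiable_eval_jInv q) τ
  have hfd : ∀ τ ∈ ModularGroup.fd, IsRegularAt (fun τ => p.eval (jInv τ) * f τ) τ := by
    intro τ hτ
    by_cases hτA : τ.im ≤ A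
    · obtain ⟨s, hs, hτs⟩ := Set.mem_iUnion₂.1 (ht ⟨hτ, hτA⟩)
      have hτs' : IsRegularAt (fun ρ => (jInv ρ - jInv s) ^ n s * f ρ) τ := hτs
      refine ((hreg (∏ s ∈ t.erase s, (Polynomial.X - Polynomial.C (jInv s)) ^ n s) τ).mul
        hτs').congr (Eventually.of_forall fun σ => ?_)
      rw [hp, ← Finset.prod_erase_mul _ _ hs, Polynomial.eval_mul]
      simp [mul_assoc]
    · exact (hreg p τ).mul (hA τ (not_le.1 hτA))
  refine ⟨p, Finset.prod_ne_zero_iff.2 fun s _ => pow_ne_zero _ (Polynomial.X_sub_C_ne_zero _),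
    fun τ => ?_⟩
  obtain ⟨γ, hγ⟩ := ModularGroup.exists_smul_mem_fd τ
  refine (hfd _ hγ).comp_smul.congr ?_
  filter_upwards [eventually_codiscrete_iff.1 (hinv γ trivial) τ] with σ hσ
  rw [hσ, jInv_smul]

/-! ### Growth at the cusp -/

/-- The product of `f` with some power of `Δ` is bounded near `i∞`. -/
def HasPolynomialGrowth (f : ℍ → ℂ) : Prop :=
  ∃ n : ℕ, (fun τ => f τ * discriminant τ ^ n) =O[codiscrete ℍ ⊓ atImInfty] (1 : ℍ → ℝ)

lemma discriminant_isBigO_one : discriminant =O[codiscrete ℍ ⊓ atImInfty] (1 : ℍ → ℝ) :=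
  (discriminant_isZeroAtImInfty.isBoundedAtImInfty).mono inf_le_right

lemma discriminant_pow_isBigO_one (n : ℕ) :
    (fun τ => discriminant τ ^ n) =O[codiscrete ℍ ⊓ atImInfty] (1 : ℍ → ℝ) := by
  have h := discriminant_isBigO_one.pow n
  simp only [Pi.one_apply, one_pow] at h
  exact h

lemma HasPolynomialGrowth.mul {f g : ℍ → ℂ} (hf : HasPolynomialGrowth f)
    (hg : HasPolynomialGrowth g) : HasPolynomialGrowth fun τ => f τ * g τ := by
  obtain ⟨m, hm⟩ := hf
  obtain ⟨n, hn⟩ := hg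
  refine ⟨m + n, ?_⟩
  have h := hm.mul hn
  simp only [Pi.one_apply, mul_one] at h
  exact h.congr_left fun τ => by ring

lemma HasPolynomialGrowth.add {f g : ℍ → ℂ} (hf : HasPolynomialGrowth f)
    (hg : HasPolynomialGrowth g) : HasPolynomialGrowth fun τ => f τ + g τ := by
  obtain ⟨m, hm⟩ := hf
  obtain ⟨n, hn⟩ := hg
  refine ⟨m + n, ?_⟩
  have h1 := hm.mul (discriminant_pow_isBigO_one n)
  have h2 := hn.mul (discriminant_pow_isBigO_one m)
  simp only [Pi.one_apply, mul_one] at h1 h2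
  exact (h1.add h2).congr_left fun τ => by ring

lemma hasPolynomialGrowth_const (c : ℂ) : HasPolynomialGrowth fun _ => c :=
  ⟨0, (Asymptotics.isBigO_const_const c (one_ne_zero (α := ℝ)) _).congr_left fun _ => by simp⟩

lemma hasPolynomialGrowth_jInv : HasPolynomialGrowth jInv := by
  refine ⟨1, ?_⟩
  have h1 : (E₄ : ℍ → ℂ) =O[codiscrete ℍ ⊓ atImInfty] (1 : ℍ → ℝ) :=
    Asymptotics.IsBigO.mono (ModularFormClass.bdd_at_infty E₄) inf_le_right
  have h2 := (h1.pow 3).const_mul_left (1 / 1728)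
  simp only [Pi.one_apply, one_pow] at h2
  refine h2.congr_left fun τ => ?_
  rw [jInv_eq]
  field_simp [discriminant_ne_zero τ]

lemma hasPolynomialGrowth_eval_jInv (p : Polynomial ℂ) :
    HasPolynomialGrowth fun τ => p.eval (jInv τ) := by
  induction p using Polynomial.induction_on' with
  | add p q hp hq => simpa using hp.add hq
  | monomial n a =>
    have h : ∀ n : ℕ, HasPolynomialGrowth fun τ => jInv τ ^ n := fun n => by
      induction n with
      | zero => simpa using hasPolynomialGrowth_const 1
      | succ n ih => simpa [pow_succ] using ih.mul hasPolynomialGrowth_jInv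
    simpa using (hasPolynomialGrowth_const a).mul (h n)

lemma hasPolynomialGrowth_of_meromorphicAt {N : ℕ} (hN : 0 < N) {f : ℍ → ℂ} {G : ℂ → ℂ}
    (hG : MeromorphicAt G 0) (h : ∀ᶠ τ : ℍ in codiscrete ℍ ⊓ atImInfty,
      f τ = G (Complex.exp (2 * Real.pi * Complex.I * τ / N))) : HasPolynomialGrowth f := by
  obtain ⟨n, hn⟩ := hG
  refine ⟨n, ?_⟩
  have h1 := hn.continuousAt.tendsto.isBigO_one (F := ℝ)
  have h2 := (h1.mono nhdsWithin_le_nhds).comp_tendsto (tendsto_qParam_atImInfty hN)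
  -- Δ is at most of the size of the local parameter, so Δⁿ absorbs the factor zⁿ that makes zⁿ G(z)
  -- analytic at 0.
  have h3 : discriminant =O[atImInfty]
      fun τ : ℍ => Complex.exp (2 * Real.pi * Complex.I * τ / N) := by
    have h4 := CuspFormClass.exp_decay_atImInfty (h := (N : ℝ)) CuspForm.discriminant
      (by exact_mod_cast hN) (by simpa using ⟨(N : ℤ), by simp⟩)
    refine (h4.trans (Asymptotics.isBigO_of_le _ fun τ => ?_))
    rw [Complex.norm_exp, Real.norm_of_nonneg (Real.exp_pos _).le, Real.exp_le_exp]
    simp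
  have h4 := h3.pow n
  have h5 : f =ᶠ[codiscrete ℍ ⊓ atImInfty]
    fun τ => G (Complex.exp (2 * Real.pi * Complex.I * τ / N)) := h
  have h6 := h5.isBigO.mul
    (h4.mono inf_le_right)
  refine h6.trans ((h2.mono inf_le_right).congr (fun τ => ?_) fun τ => rfl)
  simp [mul_comm]

end ModularFunctions

namespace ModularFunctions

open EisensteinSeries ModularForm
open scoped Manifold

/-! ### ### Level one: modular functions are rational in `j` -/

/-- A modular form of level one and weight `12 n` is `Δ ^ n` times a polynomial in `j`. -/
lemma exists_polynomial_mul_discriminant_pow (n : ℕ) {k : ℤ} (hk : k = 12 * n)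
    (F : ModularForm 𝒮ℒ k) :
    ∃ p : Polynomial ℂ, ∀ τ, F τ = p.eval (jInv τ) * discriminant τ ^ n := by
  induction n generalizing k with
  | zero =>
    obtain rfl : k = 0 := by simpa using hk
    obtain ⟨c, hc⟩ := ModularFormClass.levelOne_weight_zero_const F
    exact ⟨Polynomial.C c, fun τ => by simp [hc]⟩
  | succ n ih =>
    have hw : ((3 * (n + 1) : ℕ) : ℤ) * 4 = k := by
      rw [hk]
      push_cast
      ring
    -- The comparison form E₄^(3(n+1)) has the right weight, constant term 1, and equals (1728 j
    -- Δ)^(n+1).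
    set P : ModularForm 𝒮ℒ k := ModularForm.mcast hw (E₄.pow (3 * (n + 1))) with hP
    have hPτ : ∀ τ, P τ = (1728 * jInv τ * discriminant τ) ^ (n + 1) := fun τ => by
      rw [hP, coe_mcast, coe_pow, Pi.pow_apply, pow_mul, jInv_eq]
      congr 1
      field_simp [discriminant_ne_zero τ]
    have hP0 : (qExpansion 1 P).coeff 0 = 1 := by
      rw [hP, coe_mcast, ModularForm.qExpansion_pow one_pos one_mem_strictPeriods_SL,
        PowerSeries.coeff_zero_eq_constantCoeff, map_pow,
        ← PowerSeries.coeff_zero_eq_constantCoeff_apply, E_qExpansion_coeff_zero _ ⟨2, rfl⟩,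
        one_pow]
    set c := (qExpansion 1 F).coeff 0 with hc
    -- F − cP is a cusp form; division by Δ lowers its weight by 12, where induction applies.
    have hcusp := (isCuspForm_iff_coeffZero_eq_zero _).1 (sub_smul_isCuspForm F P hP0)
    obtain ⟨p, hp⟩ := ih (k := k - 12) (by rw [hk]; push_cast; ring)
      (CuspForm.discriminantEquiv (toCuspForm _ hcusp))
    refine ⟨Polynomial.C (c * 1728 ^ (n + 1)) * Polynomial.X ^ (n + 1) + p, fun τ => ?_⟩
    have h1 := discriminant_mul_discriminantEquiv_apply (toCuspForm _ hcusp) τ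
    rw [hp, toCuspForm_apply] at h1
    have h2 : (F - c • P) τ = F τ - c * P τ := rfl
    rw [h2, hPτ] at h1
    simp only [Polynomial.eval_add, Polynomial.eval_mul, Polynomial.eval_C, Polynomial.eval_pow,
      Polynomial.eval_X]
    linear_combination -h1

/-- An invariant holomorphic function with at most polynomial growth at the cusp is a polynomial
in `j`. -/
lemma exists_polynomial_of_hasPolynomialGrowth {g : ℍ → ℂ} (hg : MDiff g)
    (hinv : ∀ (γ : SL(2, ℤ)) τ, g (γ • τ) = g τ) (hgr : HasPolynomialGrowth g) :
    ∃ p : Polynomial ℂ, ∀ τ, g τ = p.eval (jInv τ) := by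
  obtain ⟨n, hn⟩ := hgr
  have hmd : MDiff fun τ => g τ * discriminant τ ^ n := by
    rw [UpperHalfPlane.mdifferentiable_iff]
    exact (UpperHalfPlane.mdifferentiable_iff.1 hg).mul
      ((UpperHalfPlane.mdifferentiable_iff.1 mdifferentiable_discriminant).pow n)
  have hbd := isBoundedAtImInfty_of_isBigO hmd.continuous hn
  have hslash : ∀ γ : SL(2, ℤ), (fun τ => g τ * discriminant τ ^ n) ∣[(12 * n : ℤ)] γ =
      fun τ => g τ * discriminant τ ^ n := fun γ => by
    funext τ
    have h1 := denom_int_ne_zero γ τ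
    rw [SL_slash_apply, hinv, discriminant_smul, ModularGroup.denom_apply, mul_pow,
      ← zpow_natCast (_ ^ (12 : ℤ)), ← zpow_mul, mul_comm (_ ^ (12 * (n : ℤ))), mul_assoc,
      mul_assoc,
      ← zpow_add₀ h1, add_neg_cancel, zpow_zero, mul_one]
  let F : ModularForm 𝒮ℒ (12 * n : ℤ) :=
    { toFun τ := g τ * discriminant τ ^ n
      slash_action_eq' := fun _ ⟨γ, hγ⟩ => hγ ▸ hslash γ
      holo' := hmd
      -- All cusps are equivalent to i∞ and the function is slash-invariant, so the bound at i∞ is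
      -- enough.
      bdd_at_cusps' {c} hc := by
        rw [Subgroup.IsArithmetic.isCusp_iff_isCusp_SL2Z] at hc
        rw [OnePoint.isBoundedAt_iff_forall_SL2Z hc]
        intro γ _
        rw [hslash γ]
        exact hbd }
  obtain ⟨p, hp⟩ := exists_polynomial_mul_discriminant_pow n rfl F
  refine ⟨p, fun τ => ?_⟩
  have h1 : g τ * discriminant τ ^ n = p.eval (jInv τ) * discriminant τ ^ n := hp τ
  exact mul_right_cancel₀ (pow_ne_zero _ (discriminant_ne_zero τ)) h1

/-- A modular function that is invariant under `SL(2, ℤ)` is a rational function of `j`. -/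
theorem mem_adjoin_jInv_of_smul_eq {N : ℕ} (hN : 0 < N) {Γ : Subgroup SL(2, ℤ)}
    {x : MeromorphicField} (hx : x ∈ modularFunctionField Γ N) (hinv : ∀ γ : SL(2, ℤ), γ • x = x) :
    x ∈ IntermediateField.adjoin ℂ {toField jInv isMeromorphic_jInv} := by
  obtain ⟨f, hf, rfl, -, hcusp⟩ := hx
  have hfinv : IsInvariant ⊤ f := fun γ _ => by
    have h1 := smul_toField_eq_self_iff.1 (hinv γ⁻¹)
    simpa using h1
  obtain ⟨G, hG, h1⟩ := hcusp 1
  simp only [one_smul] at h1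
  obtain ⟨p, hp0, hp⟩ := exists_polynomial_isRegularAt hN hf hfinv hG h1
  obtain ⟨g, hg, hfg⟩ := exists_mdifferentiable hp
  have hginv : ∀ (γ : SL(2, ℤ)) τ, g (γ • τ) = g τ := by
    intro γ
    refine congrFun (eq_of_eventually_codiscrete (hg.continuous.comp (continuous_smul_SL γ))
      hg.continuous ?_)
    filter_upwards [hfg, (tendsto_smul_codiscrete γ).eventually hfg, hfinv γ trivial]
      with τ h2 h3 h4
    rw [← h3, ← h2, h4, jInv_smul]
  have hgr : HasPolynomialGrowth g := by
    obtain ⟨n, hn⟩ := (hasPolynomialGrowth_eval_jInv p).mul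
      (hasPolynomialGrowth_of_meromorphicAt hN hG h1)
    refine ⟨n, hn.congr' ?_ EventuallyEq.rfl⟩
    filter_upwards [hfg.filter_mono inf_le_left] with τ hτ
    rw [hτ]
  obtain ⟨q, hq⟩ := exists_polynomial_of_hasPolynomialGrowth hg hginv hgr
  have hpq : Polynomial.aeval (toField jInv isMeromorphic_jInv) p * toField f hf =
      Polynomial.aeval (toField jInv isMeromorphic_jInv) q := by
    rw [aeval_toField_jInv, aeval_toField_jInv]
    refine (toField_eq_iff (hf := fun τ => ((isMeromorphic_of_mdifferentiable
      (mdifferentiable_eval_jInv p)) τ).mul (hf τ))).2 ?_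
    filter_upwards [hfg] with τ hτ
    rw [← hq, ← hτ]
    rfl
  rw [mul_comm, ← eq_div_iff (aeval_toField_jInv_ne_zero hp0)] at hpq
  rw [hpq]
  have hmem : ∀ r : Polynomial ℂ, Polynomial.aeval (toField jInv isMeromorphic_jInv) r ∈
      IntermediateField.adjoin ℂ {toField jInv isMeromorphic_jInv} := fun r =>
    IntermediateField.algebra_adjoin_le_adjoin ℂ _
      (Polynomial.aeval_mem_adjoin_singleton ℂ _)
  exact div_mem (hmem q) (hmem p)

end ModularFunctions

namespace ModularFunctions

/-! ### The function `q / (1 - q) ^ 2` -/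

/-- `q / (1 - q) ^ 2` with `q = exp (2 π i z)`. -/
def qFrac (z : ℂ) : ℂ :=
  Complex.exp (2 * Real.pi * Complex.I * z) / (1 - Complex.exp (2 * Real.pi * Complex.I * z)) ^ 2

lemma exp_two_pi_I_eq_one_iff {z : ℂ} :
    Complex.exp (2 * Real.pi * Complex.I * z) = 1 ↔ ∃ n : ℤ, z = n := by
  rw [Complex.exp_eq_one_iff]
  refine exists_congr fun n => ?_
  rw [mul_comm (n : ℂ)]
  exact mul_right_inj' Complex.two_pi_I_ne_zero

lemma qFrac_neg (z : ℂ) : qFrac (-z) = qFrac z := by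
  have h := Complex.exp_ne_zero (2 * Real.pi * Complex.I * z)
  rw [qFrac, qFrac, mul_neg, Complex.exp_neg]
  generalize Complex.exp (2 * Real.pi * Complex.I * z) = q at *
  by_cases hq : q = 1
  · simp [hq]
  · have h1 : 1 - q ≠ 0 := sub_ne_zero.2 (Ne.symm hq)
    have h2 : 1 - q⁻¹ = -(1 - q) / q := by field_simp; ring
    rw [h2]
    field_simp

lemma norm_exp_two_pi_I_mul (z : ℂ) :
    ‖Complex.exp (2 * Real.pi * Complex.I * z)‖ = Real.exp (-2 * Real.pi * z.im) := by
  rw [Complex.norm_exp]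
  simp

/-- By evenness Im z ≥ 0 may be assumed; then |q| = exp(−2π Im z) ≤ ρ and |1 − q| ≥ 1 − ρ. -/
lemma norm_qFrac_le {z : ℂ} {ρ : ℝ} (h : Real.exp (-2 * Real.pi * |z.im|) ≤ ρ) (hρ : ρ < 1) :
    ‖qFrac z‖ ≤ Real.exp (-2 * Real.pi * |z.im|) / (1 - ρ) ^ 2 := by
  wlog hz : 0 ≤ z.im generalizing z
  · have h1 := this (z := -z) (by simpa using h) (by simp; linarith)
    simpa [qFrac_neg] using h1
  rw [abs_of_nonneg hz] at h ⊢
  rw [qFrac, norm_div, norm_pow, norm_exp_two_pi_I_mul]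
  have h1 : 1 - ρ ≤ ‖1 - Complex.exp (2 * Real.pi * Complex.I * z)‖ := by
    have h2 := norm_sub_norm_le 1 (Complex.exp (2 * Real.pi * Complex.I * z))
    rw [norm_one, norm_exp_two_pi_I_mul] at h2
    linarith
  have h3 : 0 < 1 - ρ := by linarith
  gcongr

lemma analyticAt_qFrac {z : ℂ} (hz : Complex.exp (2 * Real.pi * Complex.I * z) ≠ 1) :
    AnalyticAt ℂ qFrac z := by
  unfold qFrac
  exact AnalyticAt.div (by fun_prop) (by fun_prop) (pow_ne_zero _ (sub_ne_zero.2 hz.symm))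

lemma summable_one_div_add_int_sq (z : ℂ) : Summable fun n : ℤ => 1 / (z + n) ^ 2 := by
  have h := EisensteinSeries.linear_right_summable z 1 (k := 2) le_rfl
  refine h.congr fun n => ?_
  rw [Int.cast_one, one_mul, one_div]
  norm_cast

lemma tsum_one_div_add_int_sq_of_im_pos {z : ℂ} (hz : 0 < z.im) :
    ∑' n : ℤ, 1 / (z + n) ^ 2 = (2 * Real.pi * Complex.I) ^ 2 * qFrac z := by
  have h := EisensteinSeries.qExpansion_identity (k := 1) le_rfl ⟨z, hz⟩
  have hq : ‖Complex.exp (2 * Real.pi * Complex.I * z)‖ < 1 := by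
    rw [norm_exp_two_pi_I_mul, Real.exp_lt_one_iff]
    nlinarith [Real.pi_pos]
  simp only [pow_one] at h
  rw [tsum_coe_mul_geometric_of_norm_lt_one hq] at h
  refine h.trans ?_
  simp [qFrac]

/-- The expansion of `π ^ 2 / sin (π z) ^ 2` in partial fractions. -/
theorem hasSum_one_div_add_int_sq {z : ℂ} (hz : Complex.exp (2 * Real.pi * Complex.I * z) ≠ 1) :
    HasSum (fun n : ℤ => 1 / (z + n) ^ 2) ((2 * Real.pi * Complex.I) ^ 2 * qFrac z) := by
  rw [(summable_one_div_add_int_sq z).hasSum_iff]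
  rcases lt_trichotomy z.im 0 with h | h | h
  · rw [← qFrac_neg, ← tsum_one_div_add_int_sq_of_im_pos (by simpa using h), ← tsum_comp_neg]
    refine tsum_congr fun n => ?_
    rw [Int.cast_neg, ← neg_sq, neg_add, neg_neg]
  -- On the real line both sides are limits along z + iε, ε → 0⁺; the terms at z dominate, since
  -- moving off the line increases |z + n|.
  · have h1 : Tendsto (fun ε : ℝ => ∑' n : ℤ, 1 / (z + ε * Complex.I + n) ^ 2) (𝓝[>] 0)
        (𝓝 (∑' n : ℤ, 1 / (z + n) ^ 2)) := by
      refine tendsto_tsum_of_dominated_convergence (summable_one_div_add_int_sq z).norm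
        (fun n => ?_) (Eventually.of_forall fun ε n => ?_)
      · have hne : z + n ≠ 0 := fun h0 => hz (exp_two_pi_I_eq_one_iff.2 ⟨-n, by
          push_cast
          linear_combination h0⟩)
        have hc : ContinuousAt (fun ε : ℝ => 1 / (z + ε * Complex.I + n) ^ 2) 0 := by
          refine ContinuousAt.div (by fun_prop) (by fun_prop) ?_
          simpa using hne
        have := hc.tendsto.mono_left (nhdsWithin_le_nhds (s := Set.Ioi 0))
        simpa using this
      · rw [norm_div, norm_div, norm_pow, norm_pow]
        have hle : ‖z + n‖ ≤ ‖z + ε * Complex.I + n‖ := by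
          refine le_trans (le_of_eq ?_) (Complex.abs_re_le_norm _)
          rw [show z + n = (((z.re + n : ℝ)) : ℂ) by apply Complex.ext <;> simp [h],
            Complex.norm_real]
          simp
        have hpos : 0 < ‖z + n‖ := norm_pos_iff.2 fun h0 => hz (exp_two_pi_I_eq_one_iff.2 ⟨-n, by
          push_cast
          linear_combination h0⟩)
        gcongr
    have h2 : Tendsto (fun ε : ℝ => (2 * Real.pi * Complex.I) ^ 2 * qFrac (z + ε * Complex.I))
        (𝓝[>] 0) (𝓝 ((2 * Real.pi * Complex.I) ^ 2 * qFrac z)) := by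
      refine Tendsto.const_mul _ ?_
      have hc : ContinuousAt (fun ε : ℝ => qFrac (z + ε * Complex.I)) 0 := by
        refine ContinuousAt.comp (g := qFrac) ?_ (by fun_prop)
        simpa using (analyticAt_qFrac hz).continuousAt
      have := hc.tendsto.mono_left (nhdsWithin_le_nhds (s := Set.Ioi 0))
      simpa using this
    refine tendsto_nhds_unique (h1.congr' ?_) h2
    filter_upwards [self_mem_nhdsWithin] with ε hε
    exact tsum_one_div_add_int_sq_of_im_pos (by simpa [h] using hε)
  · exact tsum_one_div_add_int_sq_of_im_pos h

lemma qFrac_ne_zero {z : ℂ} (hz : Complex.exp (2 * Real.pi * Complex.I * z) ≠ 1) : qFrac z ≠ 0 :=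
  div_ne_zero (Complex.exp_ne_zero _) (pow_ne_zero _ (sub_ne_zero.2 hz.symm))

/-- Clearing denominators in q/(1 − q)² = r/(1 − r)² leaves (q − r)(qr − 1) = 0. -/
lemma eq_or_eq_neg_of_qFrac_eq {z w : ℂ} (hz : Complex.exp (2 * Real.pi * Complex.I * z) ≠ 1)
    (hw : Complex.exp (2 * Real.pi * Complex.I * w) ≠ 1) (h : qFrac z = qFrac w) :
    (∃ n : ℤ, z - w = n) ∨ ∃ n : ℤ, z + w = n := by
  rw [← exp_two_pi_I_eq_one_iff, ← exp_two_pi_I_eq_one_iff, mul_sub, mul_add, Complex.exp_sub,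
    Complex.exp_add, div_eq_one_iff_eq (Complex.exp_ne_zero _)]
  rw [qFrac, qFrac, div_eq_div_iff (pow_ne_zero _ (sub_ne_zero.2 hz.symm))
    (pow_ne_zero _ (sub_ne_zero.2 hw.symm))] at h
  generalize Complex.exp (2 * Real.pi * Complex.I * z) = q at *
  generalize Complex.exp (2 * Real.pi * Complex.I * w) = r at *
  have h1 : (q - r) * (q * r - 1) = 0 := by linear_combination -h
  rcases mul_eq_zero.1 h1 with h2 | h2
  · exact Or.inl (sub_eq_zero.1 h2)
  · exact Or.inr (sub_eq_zero.1 h2)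

end ModularFunctions

namespace ModularFunctions

open scoped Manifold

/-! ### The values of `℘` at the `N`-torsion points -/

/-- The value of `℘` at the `N`-torsion point `2πi(aτ + b)/N`. -/
def torsionP (N : ℕ) (a b : ℤ) (τ : ℍ) : ℂ :=
  (periods τ).weierstrassP (2 * Real.pi * Complex.I * ((a * τ + b) / N))

lemma pFun_eq (N : ℕ) (k : ℤ) : pFun N k = torsionP N 0 k := by
  funext τ
  rw [pFun, torsionP]
  congr 1
  push_cast
  ring

lemma torsionP_add_mul {N : ℕ} (hN : 0 < N) (a b s t : ℤ) :
    torsionP N (a + N * s) (b + N * t) = torsionP N a b := by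
  funext τ
  have hN' : (N : ℂ) ≠ 0 := by exact_mod_cast hN.ne'
  rw [torsionP, torsionP, ← (periods τ).weierstrassP_add_coe
    (2 * Real.pi * Complex.I * ((a * τ + b) / N)) ((periods τ).latticeEquivProd.symm (t, s)),
    coe_latticeEquivProd_symm]
  congr 1
  push_cast
  field_simp
  ring

lemma torsionP_emod {N : ℕ} (hN : 0 < N) (a b : ℤ) :
    torsionP N (a % N) (b % N) = torsionP N a b := by
  rw [← torsionP_add_mul hN (a % N) (b % N) (a / N) (b / N), Int.emod_add_mul_ediv,
    Int.emod_add_mul_ediv]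

/-- The equivalence between `ℤ × ℤ` and the lattice of periods. -/
def latticeEquiv (τ : ℍ) : ℤ × ℤ ≃ (periods τ).lattice :=
  (Equiv.prodComm ℤ ℤ).trans (periods τ).latticeEquivProd.symm.toEquiv

lemma coe_latticeEquiv (τ : ℍ) (x : ℤ × ℤ) :
    ((latticeEquiv τ x : (periods τ).lattice) : ℂ) = 2 * Real.pi * Complex.I * (x.1 * τ + x.2) :=
  coe_latticeEquivProd_symm τ x.1 x.2

/-- Homogeneity of degree −2 absorbs (2πi)². As 1/0 = 0, the index (0, 0) contributes exactly the
term u⁻². -/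
lemma hasSum_weierstrassP_periods (τ : ℍ) (u : ℂ) :
    HasSum (fun x : ℤ × ℤ => 1 / (u - (x.1 * τ + x.2)) ^ 2 - 1 / ((x.1 : ℂ) * τ + x.2) ^ 2)
      ((2 * Real.pi * Complex.I) ^ 2 *
        (periods τ).weierstrassP (2 * Real.pi * Complex.I * u)) := by
  have h := (latticeEquiv τ).hasSum_iff.2
    ((periods τ).hasSum_weierstrassP (2 * Real.pi * Complex.I * u))
  convert! h.mul_left ((2 * Real.pi * Complex.I) ^ 2) using 1
  funext x
  have h1 : ((2 * Real.pi * Complex.I) : ℂ) ≠ 0 := Complex.two_pi_I_ne_zero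
  rw [Function.comp, coe_latticeEquiv]
  generalize (2 * Real.pi * Complex.I : ℂ) = c at *
  rw [← mul_sub, mul_pow, mul_pow]
  field_simp

/-- The linear substitution of `ℤ × ℤ` given by right multiplication by `γ`. -/
def vecMulEquiv (γ : SL(2, ℤ)) : ℤ × ℤ ≃ ℤ × ℤ where
  toFun x := (x.1 * γ 0 0 + x.2 * γ 1 0, x.1 * γ 0 1 + x.2 * γ 1 1)
  invFun x := (x.1 * γ 1 1 - x.2 * γ 1 0, -x.1 * γ 0 1 + x.2 * γ 0 0)
  left_inv x := by
    have h := Matrix.det_fin_two γ.1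
    rw [γ.2] at h
    ext
    · simp only
      linear_combination -x.1 * h
    · simp only
      linear_combination -x.2 * h
  right_inv x := by
    have h := Matrix.det_fin_two γ.1
    rw [γ.2] at h
    ext
    · simp only
      linear_combination -x.1 * h
    · simp only
      linear_combination -x.2 * h

lemma mul_coe_smul_add (γ : SL(2, ℤ)) (τ : ℍ) (x y : ℂ) :
    x * ((γ • τ : ℍ) : ℂ) + y = ((x * γ 0 0 + y * γ 1 0) * τ + (x * γ 0 1 + y * γ 1 1)) /
      ((γ 1 0 : ℤ) * τ + (γ 1 1 : ℤ)) := by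
  have h := denom_int_ne_zero γ τ
  rw [coe_smul_eq, moebius, eq_div_iff h, add_mul, ← mul_div_assoc, div_mul_cancel₀ _ h]
  ring

/-- The lattice at γτ is (cτ + d)⁻¹ times the lattice at τ in another basis, and ℘ is homogeneous of
degree −2. -/
lemma torsionP_smul (N : ℕ) (a b : ℤ) (γ : SL(2, ℤ)) (τ : ℍ) :
    torsionP N a b (γ • τ) = (((γ 1 0 : ℤ) : ℂ) * τ + (γ 1 1 : ℤ)) ^ 2 *
      torsionP N (a * γ 0 0 + b * γ 1 0) (a * γ 0 1 + b * γ 1 1) τ := by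
  have h0 := denom_int_ne_zero γ τ
  have h1 : ((2 * Real.pi * Complex.I) ^ 2 : ℂ) ≠ 0 := pow_ne_zero _ Complex.two_pi_I_ne_zero
  apply mul_left_cancel₀ h1
  rw [mul_left_comm, torsionP, torsionP, ← (hasSum_weierstrassP_periods _ _).tsum_eq,
    ← (hasSum_weierstrassP_periods _ _).tsum_eq, ← tsum_mul_left]
  refine Eq.trans (tsum_congr fun x => ?_) ((vecMulEquiv γ).tsum_eq _)
  have hscale : ∀ A B D : ℂ, 1 / (A / D - B / D) ^ 2 - 1 / (B / D) ^ 2 =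
      D ^ 2 * (1 / (A - B) ^ 2 - 1 / B ^ 2) := fun A B D => by
    rw [← sub_div, div_pow, div_pow, one_div_div, one_div_div]
    ring
  rw [mul_coe_smul_add γ τ x.1 x.2, mul_coe_smul_add γ τ a b, div_right_comm, hscale]
  simp only [vecMulEquiv, Equiv.coe_fn_mk]
  push_cast
  rfl

end ModularFunctions

namespace ModularFunctions

open scoped Manifold

/-! ### ### Row expansion of the torsion values, holomorphy and limit at i∞ -/

lemma exp_torsion_ne_one {N : ℕ} (hN : 0 < N) {a b : ℤ} (hab : ¬((N : ℤ) ∣ a ∧ (N : ℤ) ∣ b))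
    (m : ℤ) {z : ℂ} (hz : 0 < z.im) :
    Complex.exp (2 * Real.pi * Complex.I * ((a * z + b) / N - m * z)) ≠ 1 := by
  intro h
  obtain ⟨n, hn⟩ := exp_two_pi_I_eq_one_iff.1 h
  have hN' : (N : ℂ) ≠ 0 := by exact_mod_cast hN.ne'
  have h1 : ((a - m * N : ℤ) : ℂ) * z + ((b - n * N : ℤ) : ℂ) = 0 := by
    push_cast
    field_simp at hn
    linear_combination hn
  have h2 := congrArg Complex.im h1
  have h3 : a - m * N = 0 := by
    have : ((a - m * N : ℤ) : ℝ) * z.im = 0 := by simpa using h2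
    rcases mul_eq_zero.1 this with h | h
    · exact_mod_cast h
    · exact absurd h hz.ne'
  rw [h3] at h1
  have h4 : b - n * N = 0 := by
    have : ((b - n * N : ℤ) : ℂ) = 0 := by simpa using h1
    exact_mod_cast this
  exact hab ⟨⟨m, by linarith⟩, ⟨n, by linarith⟩⟩

lemma exp_mul_ne_one {m : ℤ} (hm : m ≠ 0) {z : ℂ} (hz : 0 < z.im) :
    Complex.exp (2 * Real.pi * Complex.I * (m * z)) ≠ 1 := by
  intro h
  obtain ⟨n, hn⟩ := exp_two_pi_I_eq_one_iff.1 h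
  have h2 := congrArg Complex.im hn
  simp at h2
  rcases h2 with h2 | h2
  · exact hm h2
  · exact hz.ne' h2

/-- This is 2ζ(2) = π²/3, with 1/0 = 0 at n = 0; it is the source of the constant 1/12. -/
lemma hasSum_int_inv_sq :
    HasSum (fun n : ℤ => 1 / (n : ℂ) ^ 2) ((2 * Real.pi * Complex.I) ^ 2 * (-1 / 12)) := by
  have h1 : Summable fun n : ℤ => 1 / (n : ℂ) ^ 2 := by
    simpa using summable_one_div_add_int_sq 0
  rw [h1.hasSum_iff]
  have h2 := two_mul_riemannZeta_eq_tsum_int_inv_pow_of_even (k := 2) le_rfl even_two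
  simp only [one_div]
  rw [← h2]
  push_cast
  rw [riemannZeta_two, mul_pow, Complex.I_sq]
  ring

/-- The contribution of the terms `w = mτ + n`, `n ∈ ℤ`, to the expansion of `℘`. -/
def rowTerm (N : ℕ) (a b m : ℤ) (z : ℂ) : ℂ :=
  if m = 0 then 0 else qFrac ((a * z + b) / N - m * z) - qFrac (m * z)

/-- Each row is summed over n by the partial fraction expansion. Row m = 0 gives the subtracted main
term, which is why `rowTerm` is zero there. -/
lemma hasSum_torsionP {N : ℕ} (hN : 0 < N) {a b : ℤ} (hab : ¬((N : ℤ) ∣ a ∧ (N : ℤ) ∣ b))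
    (τ : ℍ) : HasSum (fun m => rowTerm N a b m τ)
      (torsionP N a b τ - (1 / 12 + qFrac ((a * τ + b) / N))) := by
  set u : ℂ := (a * τ + b) / N with hu
  have hrow : ∀ m : ℤ, HasSum
      (fun n : ℤ => 1 / (u - (m * τ + n)) ^ 2 - 1 / ((m : ℂ) * τ + n) ^ 2)
      ((2 * Real.pi * Complex.I) ^ 2 *
        (rowTerm N a b m τ + if m = 0 then 1 / 12 + qFrac u else 0)) := by
    intro m
    have h1 : HasSum (fun n : ℤ => 1 / (u - (m * τ + n)) ^ 2)
        ((2 * Real.pi * Complex.I) ^ 2 * qFrac (u - m * τ)) := by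
      have h := (Equiv.neg ℤ).hasSum_iff.2
        (hasSum_one_div_add_int_sq (exp_torsion_ne_one hN hab m τ.im_pos))
      convert! h using 1
      funext n
      simp only [Function.comp, Equiv.neg_apply, Int.cast_neg]
      congr 2
      ring
    by_cases hm : m = 0
    · subst hm
      have h2 := h1.sub hasSum_int_inv_sq
      simp only [rowTerm, if_true, Int.cast_zero, zero_mul, zero_add, sub_zero] at h2 ⊢
      convert! h2 using 1
      ring
    · have h2 := h1.sub (hasSum_one_div_add_int_sq (exp_mul_ne_one hm τ.im_pos))
      simp only [rowTerm, if_neg hm, add_zero]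
      rw [mul_sub]
      exact h2
  have h3 := (hasSum_weierstrassP_periods τ u).prod_fiberwise hrow
  have hc : ((2 * Real.pi * Complex.I) ^ 2 : ℂ) ≠ 0 := pow_ne_zero _ Complex.two_pi_I_ne_zero
  have h4 := (hasSum_mul_left_iff hc).1 h3
  have h5 := h4.sub (hasSum_ite_eq (0 : ℤ) (1 / 12 + qFrac u))
  unfold torsionP
  simp only [add_sub_cancel_right] at h5
  exact h5

/-- The imaginary part of (aτ + b)/N − mτ is (a − Nm) Im τ / N; with a reduced mod N, row m thus
decays at least like exp(−2π|m| Im τ / N). -/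
lemma natAbs_le_abs_sub_mul {N : ℕ} {a m : ℤ} (ha : 0 ≤ a) (haN : a < N) (hm : m ≠ 0) :
    (m.natAbs : ℤ) ≤ |a - N * m| := by
  rcases lt_or_gt_of_ne hm with h | h
  · rw [abs_of_nonneg (by nlinarith)]
    have : (m.natAbs : ℤ) = -m := by omega
    nlinarith
  · have h1 : (N : ℤ) - 1 ≤ (N - 1) * m := by nlinarith
    rw [abs_of_nonpos (by nlinarith)]
    have : (m.natAbs : ℤ) = m := by omega
    nlinarith

/-- A geometric bound, uniform for Im z ≥ δ; it serves both the Weierstrass test for holomorphy and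
dominated convergence at i∞. -/
lemma norm_rowTerm_le {N : ℕ} (hN : 0 < N) {a b : ℤ} (ha : 0 ≤ a) (haN : a < N) {δ : ℝ}
    (hδ : 0 < δ) (m : ℤ) {z : ℂ} (hz : δ ≤ z.im) :
    ‖rowTerm N a b m z‖ ≤ 2 * (Real.exp (-2 * Real.pi * z.im / N) ^ m.natAbs /
      (1 - Real.exp (-2 * Real.pi * δ / N)) ^ 2) := by
  have hN' : (0 : ℝ) < N := by exact_mod_cast hN
  have hpi := Real.pi_pos
  unfold rowTerm
  split_ifs with hm
  · rw [norm_zero]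
    positivity
  set ρ := Real.exp (-2 * Real.pi * δ / N) with hρ
  have hρ1 : ρ < 1 := by
    rw [hρ, Real.exp_lt_one_iff]
    have : 0 < 2 * Real.pi * δ / N := by positivity
    have h2 : -2 * Real.pi * δ / N = -(2 * Real.pi * δ / N) := by ring
    linarith
  have key : ∀ w : ℂ, m.natAbs * z.im / N ≤ |w.im| →
      ‖qFrac w‖ ≤ Real.exp (-2 * Real.pi * z.im / N) ^ m.natAbs / (1 - ρ) ^ 2 := by
    intro w hw
    have h1 : Real.exp (-2 * Real.pi * |w.im|) ≤ Real.exp (-2 * Real.pi * z.im / N) ^ m.natAbs := by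
      rw [← Real.exp_nat_mul, Real.exp_le_exp]
      have : m.natAbs * (-2 * Real.pi * z.im / N) = -2 * Real.pi * (m.natAbs * z.im / N) := by ring
      rw [this]
      nlinarith
    have h2 : Real.exp (-2 * Real.pi * |w.im|) ≤ ρ := by
      rw [hρ, Real.exp_le_exp]
      have h3 : (1 : ℝ) ≤ m.natAbs := by
        exact_mod_cast Nat.one_le_iff_ne_zero.2 (Int.natAbs_ne_zero.2 hm)
      have h4 : δ / N ≤ |w.im| := by
        refine le_trans ?_ hw
        gcongr
        nlinarith
      have : -2 * Real.pi * δ / N = -2 * Real.pi * (δ / N) := by ring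
      rw [this]
      nlinarith
    refine (norm_qFrac_le h2 hρ1).trans ?_
    gcongr
  have hz0 : 0 < z.im := hδ.trans_le hz
  have h1 : m.natAbs * z.im / N ≤ |((a * z + b) / N - m * z).im| := by
    have h2 : ((a * z + b) / N - m * z).im = ((a - N * m : ℤ) : ℝ) * z.im / N := by
      have : ((a * z + b) / N - m * z : ℂ) =
          ((((a - N * m : ℤ) : ℝ) / (N : ℝ) : ℝ) : ℂ) * z + ((b / N : ℝ) : ℂ) := by
        have hNc : (N : ℂ) ≠ 0 := by exact_mod_cast hN.ne'
        push_cast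
        field_simp
        ring
      rw [this, Complex.add_im, Complex.im_ofReal_mul,
        Complex.ofReal_im, add_zero]
      ring
    rw [h2, abs_div, abs_mul, abs_of_pos hz0, abs_of_pos hN', ← Int.cast_abs]
    have h3 : ((m.natAbs : ℤ) : ℝ) ≤ ((|a - N * m| : ℤ) : ℝ) :=
      Int.cast_le.2 (natAbs_le_abs_sub_mul ha haN hm)
    rw [Int.cast_natCast] at h3
    gcongr
  have h2 : m.natAbs * z.im / N ≤ |((m : ℂ) * z).im| := by
    have h3 : ((m : ℂ) * z).im = m * z.im := by simp
    rw [h3, abs_mul, abs_of_pos hz0, Nat.cast_natAbs, Int.cast_abs]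
    have : (1 : ℝ) ≤ N := by exact_mod_cast hN
    exact div_le_self (by positivity) this
  calc _ ≤ _ := norm_sub_le _ _
    _ ≤ _ := add_le_add (key _ h1) (key _ h2)
    _ = _ := by ring

lemma summable_pow_natAbs {ρ : ℝ} (h0 : 0 ≤ ρ) (h1 : ρ < 1) :
    Summable fun m : ℤ => ρ ^ m.natAbs := by
  rw [summable_int_iff_summable_nat_and_neg]
  simpa using summable_geometric_of_lt_one h0 h1

lemma exp_neg_div_lt_one {N : ℕ} (hN : 0 < N) {δ : ℝ} (hδ : 0 < δ) :
    Real.exp (-2 * Real.pi * δ / N) < 1 := by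
  have hN' : (0 : ℝ) < N := by exact_mod_cast hN
  rw [Real.exp_lt_one_iff]
  have : 0 < 2 * Real.pi * δ / N := by positivity
  have h2 : -2 * Real.pi * δ / N = -(2 * Real.pi * δ / N) := by ring
  linarith

lemma torsionP_eq {N : ℕ} (hN : 0 < N) {a b : ℤ} (hab : ¬((N : ℤ) ∣ a ∧ (N : ℤ) ∣ b)) (τ : ℍ) :
    torsionP N a b τ = 1 / 12 + qFrac ((a * τ + b) / N) + ∑' m, rowTerm N a b m τ := by
  rw [(hasSum_torsionP hN hab τ).tsum_eq]
  ring

lemma mdifferentiable_torsionP_of_lt {N : ℕ} (hN : 0 < N) {a b : ℤ}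
    (hab : ¬((N : ℤ) ∣ a ∧ (N : ℤ) ∣ b)) (ha : 0 ≤ a) (haN : a < N) : MDiff (torsionP N a b) := by
  rw [UpperHalfPlane.mdifferentiable_iff]
  intro z hz
  replace hz : 0 < z.im := hz
  -- The row bounds are uniform on the open half plane Im w > Im z / 2, which contains z.
  set δ := z.im / 2 with hδ
  have hδ0 : 0 < δ := by positivity
  set U : Set ℂ := {w | δ < w.im} with hU
  have hUo : IsOpen U := isOpen_lt continuous_const Complex.continuous_im
  have hd : DifferentiableOn ℂ
      (fun w : ℂ => 1 / 12 + qFrac ((a * w + b) / N) + ∑' m, rowTerm N a b m w) U := by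
    refine DifferentiableOn.add (fun w hw => ?_) ?_
    · have hw' : 0 < w.im := hδ0.trans hw
      have h1 := analyticAt_qFrac (by simpa using exp_torsion_ne_one hN hab 0 hw')
      exact (DifferentiableAt.const_add _
        (h1.differentiableAt.fun_comp' w (by fun_prop))).differentiableWithinAt
    · refine Complex.differentiableOn_tsum_of_summable_norm
        (u := fun m => 2 * (Real.exp (-2 * Real.pi * δ / N) ^ m.natAbs /
          (1 - Real.exp (-2 * Real.pi * δ / N)) ^ 2))
        (((summable_pow_natAbs (Real.exp_pos _).le (exp_neg_div_lt_one hN hδ0)).div_const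
          _).mul_left _) (fun m w hw => ?_) hUo (fun m w hw => ?_)
      · have hw' : 0 < w.im := hδ0.trans hw
        unfold rowTerm
        split_ifs with hm
        · exact differentiableWithinAt_const _
        · have h1 := analyticAt_qFrac (exp_torsion_ne_one hN hab m hw')
          have h2 := analyticAt_qFrac (exp_mul_ne_one hm hw')
          exact ((h1.differentiableAt.fun_comp' w (by fun_prop)).sub
            (h2.differentiableAt.fun_comp' w (by fun_prop))).differentiableWithinAt
      · refine (norm_rowTerm_le hN ha haN hδ0 m (le_of_lt hw)).trans ?_
        have hw2 : δ < w.im := hw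
        have hpi := Real.pi_pos
        have : -2 * Real.pi * w.im / N ≤ -2 * Real.pi * δ / N := by
          gcongr ?_ / _
          nlinarith
        gcongr
  have hzU : z ∈ U := by
    change δ < z.im
    linarith
  refine ((hd.differentiableAt (hUo.mem_nhds hzU)).congr_of_eventuallyEq
    ?_).differentiableWithinAt
  filter_upwards [isOpen_upperHalfPlaneSet.mem_nhds hz] with w hw
  rw [Function.comp, torsionP_eq hN hab, ofComplex_apply_of_im_pos hw]

lemma tendsto_exp_neg_im_atImInfty {c : ℝ} (hc : 0 < c) :
    Tendsto (fun τ : ℍ => Real.exp (-2 * Real.pi * τ.im * c)) atImInfty (𝓝 0) := by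
  refine Real.tendsto_exp_atBot.comp ?_
  have h1 : Tendsto (fun τ : ℍ => (2 * Real.pi * c) * τ.im) atImInfty atTop :=
    Tendsto.const_mul_atTop (by positivity) tendsto_comap
  refine (tendsto_neg_atTop_atBot.comp h1).congr fun τ => ?_
  simp only [Function.comp]
  ring

lemma tendsto_torsionP_of_lt {N : ℕ} (hN : 0 < N) {a b : ℤ}
    (hab : ¬((N : ℤ) ∣ a ∧ (N : ℤ) ∣ b)) (ha : 0 ≤ a) (haN : a < N) :
    Tendsto (torsionP N a b) atImInfty
      (𝓝 (1 / 12 + if a = 0 then qFrac (b / N) else 0)) := by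
  have hN' : (0 : ℝ) < N := by exact_mod_cast hN
  have hlarge : ∀ᶠ τ : ℍ in atImInfty, 1 ≤ τ.im := (atImInfty_mem _).2 ⟨1, fun _ h => h⟩
  have h1 : Tendsto (fun τ : ℍ => ∑' m, rowTerm N a b m τ) atImInfty (𝓝 0) := by
    have h2 : Tendsto (fun τ : ℍ => ∑' m, rowTerm N a b m τ) atImInfty
        (𝓝 (∑' _ : ℤ, (0 : ℂ))) := by
      refine tendsto_tsum_of_dominated_convergence
        (bound := fun m => 2 * (Real.exp (-2 * Real.pi * 1 / N) ^ m.natAbs /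
          (1 - Real.exp (-2 * Real.pi * 1 / N)) ^ 2))
        (((summable_pow_natAbs (Real.exp_pos _).le (exp_neg_div_lt_one hN one_pos)).div_const
          _).mul_left _) (fun m => ?_) ?_
      · by_cases hm : m = 0
        · simp [rowTerm, hm]
        have h3 := ((tendsto_exp_neg_im_atImInfty (c := 1 / N) (by positivity)).pow
          m.natAbs).div_const ((1 - Real.exp (-2 * Real.pi * 1 / N)) ^ 2) |>.const_mul 2
        rw [zero_pow (Int.natAbs_ne_zero.2 hm), zero_div, mul_zero] at h3
        refine squeeze_zero_norm' ?_ h3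
        filter_upwards [hlarge] with τ hτ
        refine (norm_rowTerm_le hN ha haN one_pos m hτ).trans (le_of_eq ?_)
        rw [mul_one_div]
        rfl
      · filter_upwards [hlarge] with τ hτ m
        refine (norm_rowTerm_le hN ha haN one_pos m hτ).trans ?_
        have hpi := Real.pi_pos
        have : -2 * Real.pi * (τ : ℂ).im / N ≤ -2 * Real.pi * 1 / N := by
          gcongr ?_ / _
          have : 1 ≤ (τ : ℂ).im := hτ
          nlinarith
        gcongr
    simpa using h2
  have h2 : Tendsto (fun τ : ℍ => qFrac ((a * τ + b) / N)) atImInfty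
      (𝓝 (if a = 0 then qFrac (b / N) else 0)) := by
    split_ifs with h0
    · subst h0
      simp
    · have ha1 : (1 : ℝ) ≤ a := by exact_mod_cast lt_of_le_of_ne ha (Ne.symm h0)
      have h3 := (tendsto_exp_neg_im_atImInfty (c := 1 / N) (by positivity)).div_const
        ((1 - Real.exp (-2 * Real.pi * 1 / N)) ^ 2)
      rw [zero_div] at h3
      refine squeeze_zero_norm' ?_ h3
      filter_upwards [hlarge] with τ hτ
      have h4 : ((a * τ + b) / N : ℂ).im = a * τ.im / N := by
        have : ((a * τ + b) / N : ℂ) = ((a / N : ℝ) : ℂ) * τ + ((b / N : ℝ) : ℂ) := by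
          push_cast
          ring
        rw [this, Complex.add_im, Complex.im_ofReal_mul, Complex.ofReal_im, add_zero, coe_im]
        ring
      have h5 : τ.im * (1 / N) ≤ |((a * τ + b) / N : ℂ).im| := by
        rw [h4, abs_of_nonneg (by positivity), mul_one_div]
        gcongr
        nlinarith
      have hpi := Real.pi_pos
      refine (norm_qFrac_le (ρ := Real.exp (-2 * Real.pi * 1 / N)) ?_
        (exp_neg_div_lt_one hN one_pos)).trans ?_
      · rw [Real.exp_le_exp]
        have h6 : (1 : ℝ) / N ≤ τ.im * (1 / N) := le_mul_of_one_le_left (by positivity) hτ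
        have : -2 * Real.pi * 1 / N = -2 * Real.pi * (1 / N) := by ring
        rw [this]
        nlinarith
      · have h6 : -2 * Real.pi * |((a * τ + b) / N : ℂ).im| ≤ -2 * Real.pi * τ.im * (1 / N) := by
          have : -2 * Real.pi * τ.im * (1 / N) = -2 * Real.pi * (τ.im * (1 / N)) := by ring
          rw [this]
          nlinarith
        exact div_le_div_of_nonneg_right (Real.exp_le_exp.2 h6) (sq_nonneg _)
  have h3 := (h2.const_add (1 / 12)).add h1
  rw [add_zero] at h3
  exact h3.congr fun τ => (torsionP_eq hN hab τ).symm

end ModularFunctions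

namespace ModularFunctions

open EisensteinSeries ModularForm
open scoped Manifold

/-! ### Expansions at the cusps -/

/-- A bounded holomorphic function of period N extends over 0 in the variable exp(2πiτ/N). -/
lemma exists_meromorphicAt_of_bounded {N : ℕ} (hN : 0 < N) {f : ℍ → ℂ} (hf : MDiff f)
    (hper : ∀ τ, f (ModularGroup.T ^ (N : ℤ) • τ) = f τ) (hbd : IsBoundedAtImInfty f) :
    ∃ G : ℂ → ℂ, MeromorphicAt G 0 ∧
      ∀ τ : ℍ, f τ = G (Complex.exp (2 * Real.pi * Complex.I * τ / N)) := by
  have hN' : (0 : ℝ) < N := by exact_mod_cast hN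
  have hP : Function.Periodic (f ∘ ofComplex) ((N : ℝ) : ℂ) := by
    intro w
    by_cases! hw : 0 < w.im
    · have hw' : 0 < (w + ((N : ℝ) : ℂ)).im := by simpa using hw
      simp only [Function.comp_apply, ofComplex_apply_of_im_pos hw', ofComplex_apply_of_im_pos hw]
      rw [← hper ⟨w, hw⟩]
      congr 1
      ext
      rw [ModularGroup.coe_T_zpow_smul_eq]
      simp
    -- Outside the upper half plane `ofComplex` takes a single default value.
    · have hw' : (w + ((N : ℝ) : ℂ)).im ≤ 0 := by simpa using hw
      simp only [Function.comp_apply, ofComplex_apply_of_im_nonpos hw',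
        ofComplex_apply_of_im_nonpos hw]
  refine ⟨cuspFunction N f, (analyticAt_cuspFunction_zero hN' hP hf hbd).meromorphicAt,
    fun τ => ?_⟩
  rw [← UpperHalfPlane.eq_cuspFunction τ hN'.ne' hP, Function.Periodic.qParam]
  push_cast
  rfl

lemma not_dvd_emod {N : ℕ} {a b : ℤ} (hab : ¬((N : ℤ) ∣ a ∧ (N : ℤ) ∣ b)) :
    ¬((N : ℤ) ∣ a % N ∧ (N : ℤ) ∣ b) := by
  rwa [Int.dvd_iff_emod_eq_zero, Int.emod_emod, ← Int.dvd_iff_emod_eq_zero]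

lemma torsionP_emod_left {N : ℕ} (hN : 0 < N) (a b : ℤ) :
    torsionP N (a % N) b = torsionP N a b := by
  have h := torsionP_add_mul hN (a % N) b (a / N) 0
  rw [Int.emod_add_mul_ediv, mul_zero, add_zero] at h
  exact h.symm

section

variable {N : ℕ} (hN : 0 < N) {a b : ℤ} (hab : ¬((N : ℤ) ∣ a ∧ (N : ℤ) ∣ b))
include hN hab

lemma mdifferentiable_torsionP : MDiff (torsionP N a b) := by
  have hN' : (0 : ℤ) < N := by exact_mod_cast hN
  rw [← torsionP_emod_left hN]
  exact mdifferentiable_torsionP_of_lt hN (not_dvd_emod hab) (Int.emod_nonneg _ hN'.ne')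
    (Int.emod_lt_of_pos _ hN')

lemma tendsto_torsionP : Tendsto (torsionP N a b) atImInfty
    (𝓝 (1 / 12 + if (N : ℤ) ∣ a then qFrac (b / N) else 0)) := by
  have hN' : (0 : ℤ) < N := by exact_mod_cast hN
  rw [← torsionP_emod_left hN]
  simp only [Int.dvd_iff_emod_eq_zero]
  exact tendsto_torsionP_of_lt hN (not_dvd_emod hab) (Int.emod_nonneg _ hN'.ne')
    (Int.emod_lt_of_pos _ hN')

end

/-- The function `g₂ g₃ ℘(2πi(aτ + b)/N) / Δ` of weight zero. -/
def fricke (N : ℕ) (a b : ℤ) (τ : ℍ) : ℂ := g2 τ * g3 τ * torsionP N a b τ / Delta τ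

lemma fFun_eq (N : ℕ) (k : ℤ) : fFun N k = fricke N 0 k := by
  funext τ
  rw [fFun, pFun_eq, fricke]

lemma fricke_emod {N : ℕ} (hN : 0 < N) (a b : ℤ) :
    fricke N (a % N) (b % N) = fricke N a b := by
  funext τ
  rw [fricke, torsionP_emod hN, fricke]

/-- The weights add up to 4 + 6 + 2 − 12 = 0. -/
lemma fricke_smul (N : ℕ) (a b : ℤ) (γ : SL(2, ℤ)) (τ : ℍ) :
    fricke N a b (γ • τ) = fricke N (a * γ 0 0 + b * γ 1 0) (a * γ 0 1 + b * γ 1 1) τ := by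
  rw [fricke, fricke, g2_smul, g3_smul, Delta_smul, torsionP_smul,
    ← mul_div_mul_left _ (Delta τ) (pow_ne_zero 12 (denom_int_ne_zero γ τ))]
  congr 1
  ring

lemma not_dvd_vecMul {N : ℕ} {a b : ℤ} (hab : ¬((N : ℤ) ∣ a ∧ (N : ℤ) ∣ b)) (γ : SL(2, ℤ)) :
    ¬((N : ℤ) ∣ a * γ 0 0 + b * γ 1 0 ∧ (N : ℤ) ∣ a * γ 0 1 + b * γ 1 1) := by
  rintro ⟨h1, h2⟩
  have h := Matrix.det_fin_two γ.1
  rw [γ.2] at h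
  refine hab ⟨?_, ?_⟩
  · have e : a = (a * γ 0 0 + b * γ 1 0) * γ 1 1 - (a * γ 0 1 + b * γ 1 1) * γ 1 0 := by
      linear_combination a * h
    rw [e]
    exact dvd_sub (h1.mul_right _) (h2.mul_right _)
  · have e : b = (a * γ 0 1 + b * γ 1 1) * γ 0 0 - (a * γ 0 0 + b * γ 1 0) * γ 0 1 := by
      linear_combination b * h
    rw [e]
    exact dvd_sub (h2.mul_right _) (h1.mul_right _)

lemma not_dvd_of_isCoprime {N : ℕ} (hN : 1 < N) {k : ℤ} (hk : IsCoprime k (N : ℤ)) :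
    ¬((N : ℤ) ∣ 0 ∧ (N : ℤ) ∣ k) := fun h => by
  have h1 := hk.isUnit_of_dvd' h.2 dvd_rfl
  rw [Int.isUnit_iff] at h1
  omega

lemma T_pow_apply (n : ℤ) : (ModularGroup.T ^ n) 0 0 = 1 ∧ (ModularGroup.T ^ n) 0 1 = n ∧
    (ModularGroup.T ^ n) 1 0 = 0 ∧ (ModularGroup.T ^ n) 1 1 = 1 := by
  simp [ModularGroup.coe_T_zpow]

section

variable {N : ℕ} (hN : 0 < N) {a b : ℤ} (hab : ¬((N : ℤ) ∣ a ∧ (N : ℤ) ∣ b))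
include hN

lemma exists_meromorphicAt_g2 : ∃ G : ℂ → ℂ, MeromorphicAt G 0 ∧
    ∀ τ : ℍ, g2 τ = G (Complex.exp (2 * Real.pi * Complex.I * τ / N)) := by
  obtain ⟨-, -, h10, h11⟩ := T_pow_apply N
  refine exists_meromorphicAt_of_bounded hN mdifferentiable_g2 (fun τ => ?_) ?_
  · rw [g2_smul, h10, h11]
    simp
  · rw [show g2 = fun τ => 4 * (Real.pi : ℂ) ^ 4 / 3 * E₄ τ from funext g2_eq]
    exact Asymptotics.IsBigO.const_mul_left (ModularFormClass.bdd_at_infty E₄) _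

lemma exists_meromorphicAt_g3 : ∃ G : ℂ → ℂ, MeromorphicAt G 0 ∧
    ∀ τ : ℍ, g3 τ = G (Complex.exp (2 * Real.pi * Complex.I * τ / N)) := by
  obtain ⟨-, -, h10, h11⟩ := T_pow_apply N
  refine exists_meromorphicAt_of_bounded hN mdifferentiable_g3 (fun τ => ?_) ?_
  · rw [g3_smul, h10, h11]
    simp
  · rw [show g3 = fun τ => 8 * (Real.pi : ℂ) ^ 6 / 27 * E₆ τ from funext g3_eq]
    exact Asymptotics.IsBigO.const_mul_left (ModularFormClass.bdd_at_infty E₆) _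

lemma exists_meromorphicAt_Delta : ∃ G : ℂ → ℂ, MeromorphicAt G 0 ∧
    ∀ τ : ℍ, Delta τ = G (Complex.exp (2 * Real.pi * Complex.I * τ / N)) := by
  obtain ⟨F, hF, h2⟩ := exists_meromorphicAt_g2 hN
  obtain ⟨G, hG, h3⟩ := exists_meromorphicAt_g3 hN
  refine ⟨F ^ 3 - (fun _ => 27) * G ^ 2,
    (hF.pow 3).sub ((MeromorphicAt.const 27 0).mul (hG.pow 2)), fun τ => ?_⟩
  simp only [Pi.sub_apply, Pi.mul_apply, Pi.pow_apply, ← h2, ← h3]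
  rfl

lemma exists_meromorphicAt_jInv : ∃ G : ℂ → ℂ, MeromorphicAt G 0 ∧
    ∀ τ : ℍ, jInv τ = G (Complex.exp (2 * Real.pi * Complex.I * τ / N)) := by
  obtain ⟨F, hF, h2⟩ := exists_meromorphicAt_g2 hN
  obtain ⟨D, hD, h3⟩ := exists_meromorphicAt_Delta hN
  refine ⟨F ^ 3 / D, (hF.pow 3).div hD, fun τ => ?_⟩
  simp only [Pi.div_apply, Pi.pow_apply, ← h2, ← h3]
  rfl

include hab

lemma exists_meromorphicAt_fricke : ∃ G : ℂ → ℂ, MeromorphicAt G 0 ∧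
    ∀ τ : ℍ, fricke N a b τ = G (Complex.exp (2 * Real.pi * Complex.I * τ / N)) := by
  obtain ⟨h00, h01, h10, h11⟩ := T_pow_apply N
  obtain ⟨F, hF, h2⟩ := exists_meromorphicAt_g2 hN
  obtain ⟨G, hG, h3⟩ := exists_meromorphicAt_g3 hN
  obtain ⟨D, hD, hΔ⟩ := exists_meromorphicAt_Delta hN
  obtain ⟨P, hP, hp⟩ := exists_meromorphicAt_of_bounded hN (mdifferentiable_torsionP hN hab)
    -- Tᴺ sends the index (a, b) to (a, b + Na), which is the same mod N.
    (fun τ => by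
      rw [torsionP_smul, h00, h01, h10, h11]
      have h := torsionP_add_mul hN a b 0 a
      rw [mul_zero, add_zero] at h
      simp only [Int.cast_zero, zero_mul, Int.cast_one, zero_add, one_pow, one_mul, mul_one,
        mul_zero, add_zero]
      rw [add_comm, mul_comm, h])
    ((tendsto_torsionP hN hab).isBigO_one (F := ℝ))
  refine ⟨F * G * P / D, ((hF.mul hG).mul hP).div hD, fun τ => ?_⟩
  simp only [Pi.div_apply, Pi.mul_apply, ← h2, ← h3, ← hΔ, ← hp]
  rfl

lemma mdifferentiable_fricke : MDiff (fricke N a b) := by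
  rw [UpperHalfPlane.mdifferentiable_iff]
  exact (((UpperHalfPlane.mdifferentiable_iff.1 mdifferentiable_g2).mul
    (UpperHalfPlane.mdifferentiable_iff.1 mdifferentiable_g3)).mul
    (UpperHalfPlane.mdifferentiable_iff.1 (mdifferentiable_torsionP hN hab))).div
    (UpperHalfPlane.mdifferentiable_iff.1 mdifferentiable_Delta) fun z _ => Delta_ne_zero _

lemma isMeromorphic_fricke : IsMeromorphic (fricke N a b) :=
  isMeromorphic_of_mdifferentiable (mdifferentiable_fricke hN hab)

/-- Translation by γ gives another function of the family, so expansions at i∞ cover every cusp. -/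
lemma isMeromorphicAtCusps_fricke : IsMeromorphicAtCusps N (fricke N a b) := fun γ => by
  obtain ⟨G, hG, h⟩ := exists_meromorphicAt_fricke hN (not_dvd_vecMul hab γ)
  exact ⟨G, hG, Eventually.of_forall fun τ => by rw [fricke_smul, h]⟩

end

/-! ### ### Invariance and the orbit of `f_k` -/

lemma toField_jInv_mem {N : ℕ} (hN : 0 < N) (Γ : Subgroup SL(2, ℤ)) :
    toField jInv isMeromorphic_jInv ∈ modularFunctionField Γ N := by
  obtain ⟨G, hG, h⟩ := exists_meromorphicAt_jInv hN
  exact ⟨jInv, isMeromorphic_jInv, rfl, fun γ _ => Eventually.of_forall (jInv_smul γ),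
    fun γ => ⟨G, hG, Eventually.of_forall fun τ => by rw [jInv_smul, h]⟩⟩

lemma fricke_congr {N : ℕ} (hN : 0 < N) {a b a' b' : ℤ} (ha : a ≡ a' [ZMOD N])
    (hb : b ≡ b' [ZMOD N]) : fricke N a b = fricke N a' b' := by
  rw [← fricke_emod hN a, ← fricke_emod hN a', ha.eq, hb.eq]

/-- (0, k)γ = (kc, kd) ≡ (0, k) mod N for γ in Γ₁(N). -/
lemma isInvariant_fricke {N : ℕ} (hN : 0 < N) (k : ℤ) :
    IsInvariant (CongruenceSubgroup.Gamma1 N) (fricke N 0 k) := fun γ hγ => by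
  obtain ⟨-, h1, h0⟩ := (CongruenceSubgroup.Gamma1_mem N γ).1 hγ
  refine Eventually.of_forall fun τ => ?_
  rw [fricke_smul, zero_mul, zero_mul, zero_add, zero_add]
  refine congrFun (fricke_congr hN ?_ ?_) τ
  · rw [← ZMod.intCast_eq_intCast_iff]
    push_cast
    rw [h0, mul_zero]
  · rw [← ZMod.intCast_eq_intCast_iff]
    push_cast
    rw [h1, mul_one]

/-- With the trivial group only the condition at the cusps remains. This gives a field stable under
`SL(2, ℤ)`, in which the interpolation takes place. -/
lemma smul_mem_modularFunctionField_bot {N : ℕ} {Γ : Subgroup SL(2, ℤ)} {x : MeromorphicField}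
    (hx : x ∈ modularFunctionField Γ N) (γ : SL(2, ℤ)) : γ • x ∈ modularFunctionField ⊥ N := by
  obtain ⟨f, hf, rfl, -, hc⟩ := hx
  refine ⟨fun τ => f (γ⁻¹ • τ), hf.comp_smul γ⁻¹, rfl, fun δ hδ => ?_, fun δ => ?_⟩
  · rw [Subgroup.mem_bot.1 hδ]
    exact Eventually.of_forall fun τ => by rw [one_smul]
  · obtain ⟨G, hG, h⟩ := hc (γ⁻¹ * δ)
    refine ⟨G, hG, ?_⟩
    filter_upwards [h] with τ hτ
    rw [← hτ, mul_smul]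

/-- The translates of `fricke N a b` are among the finitely many functions with index modulo
`N`. -/
lemma finite_orbit_fricke {N : ℕ} (hN : 0 < N) {a b : ℤ} (hf : IsMeromorphic (fricke N a b)) :
    (MulAction.orbit SL(2, ℤ) (toField (fricke N a b) hf)).Finite := by
  classical
  have hN' : (0 : ℤ) < N := by exact_mod_cast hN
  -- The default value 0 makes the family total without a meromorphy proof for each index; (0, 0) is
  -- among them.
  have hfin : (Set.image2 (fun m n : ℤ => if h : IsMeromorphic (fricke N m n) then
      toField (fricke N m n) h else 0) (Set.Ico 0 (N : ℤ)) (Set.Ico 0 (N : ℤ))).Finite :=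
    (Set.finite_Ico _ _).image2 _ (Set.finite_Ico _ _)
  refine hfin.subset ?_
  rintro _ ⟨γ, rfl⟩
  obtain ⟨m, n, h1⟩ : ∃ m n : ℤ, ∀ τ, fricke N a b (γ⁻¹ • τ) = fricke N m n τ :=
    ⟨_, _, fun τ => fricke_smul N a b γ⁻¹ τ⟩
  rw [← fricke_emod hN m n] at h1
  have h2 : IsMeromorphic (fricke N (m % N) (n % N)) := funext h1 ▸ hf.comp_smul γ⁻¹
  refine ⟨m % N, ⟨Int.emod_nonneg _ hN'.ne', Int.emod_lt_of_pos _ hN'⟩, n % N,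
    ⟨Int.emod_nonneg _ hN'.ne', Int.emod_lt_of_pos _ hN'⟩, (dif_pos h2).trans ?_⟩
  refine Eq.trans ?_ (smul_toField γ _ hf).symm
  exact toField_eq_iff.2 (Eventually.of_forall fun τ => (h1 τ).symm)

/-! ### ### The stabilizer of `f_k` and the conclusion -/

lemma eventually_ne_zero_of_coeff_zero {k : ℤ} (f : ModularForm 𝒮ℒ k)
    (hf : (qExpansion 1 f).coeff 0 = 1) : ∀ᶠ τ in atImInfty, f τ ≠ 0 := by
  have han := ModularFormClass.analyticAt_cuspFunction_zero f one_pos one_mem_strictPeriods_SL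
  have h0 : cuspFunction 1 f 0 = 1 := by
    rw [← hf, UpperHalfPlane.qExpansion_coeff, iteratedDeriv_zero]
    simp
  have h1 := han.continuousAt.tendsto.comp (qParam_tendsto_atImInfty one_pos)
  rw [h0] at h1
  filter_upwards [h1.eventually_ne one_ne_zero] with τ hτ
  rwa [Function.comp, SlashInvariantFormClass.eq_cuspFunction f τ one_mem_strictPeriods_SL
    one_ne_zero] at hτ

/-- Allows g₂ g₃ to be cancelled near i∞, so that an equality of `fricke` functions becomes one of
torsion values. -/
lemma eventually_g2_mul_g3_ne_zero : ∀ᶠ τ in atImInfty, g2 τ * g3 τ ≠ 0 := by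
  have hpi : (Real.pi : ℂ) ≠ 0 := by exact_mod_cast Real.pi_ne_zero
  filter_upwards [eventually_ne_zero_of_coeff_zero E₄ (E_qExpansion_coeff_zero _ ⟨2, rfl⟩),
    eventually_ne_zero_of_coeff_zero E₆ (E_qExpansion_coeff_zero _ ⟨3, rfl⟩)] with τ h4 h6
  rw [g2_eq, g3_eq]
  exact mul_ne_zero (mul_ne_zero (by simp [hpi]) h4) (mul_ne_zero (by simp [hpi]) h6)

/-- If `fricke N 0 k` and `fricke N a b` agree, then so do their indices up to sign. -/
lemma index_eq_of_fricke_eq {N : ℕ} (hN : 0 < N) {k a b : ℤ} (hk : ¬(N : ℤ) ∣ k)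
    (hab : ¬((N : ℤ) ∣ a ∧ (N : ℤ) ∣ b))
    (h : ∀ᶠ τ in codiscrete ℍ, fricke N a b τ = fricke N 0 k τ) :
    (N : ℤ) ∣ a ∧ ((N : ℤ) ∣ b - k ∨ (N : ℤ) ∣ b + k) := by
  have hN' : (N : ℂ) ≠ 0 := by exact_mod_cast hN.ne'
  have h0k : ¬((N : ℤ) ∣ 0 ∧ (N : ℤ) ∣ k) := fun h => hk h.2
  have h1 := eq_of_eventually_codiscrete (mdifferentiable_fricke hN hab).continuous
    (mdifferentiable_fricke hN h0k).continuous h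
  have h2 : torsionP N a b =ᶠ[atImInfty] torsionP N 0 k := by
    filter_upwards [eventually_g2_mul_g3_ne_zero] with τ hτ
    have h3 := congrFun h1 τ
    rw [fricke, fricke, div_left_inj' (Delta_ne_zero τ)] at h3
    exact mul_left_cancel₀ hτ h3
  have h3 := tendsto_nhds_unique ((tendsto_torsionP hN hab).congr' h2) (tendsto_torsionP hN h0k)
  rw [if_pos (dvd_zero _), add_right_inj] at h3
  have hne : ∀ {c : ℤ}, ¬(N : ℤ) ∣ c →
      Complex.exp (2 * Real.pi * Complex.I * ((c : ℂ) / N)) ≠ 1 := fun {c} hc => by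
    simpa using exp_torsion_ne_one hN (a := 0) (b := c) (fun h => hc h.2) 0 I.im_pos
  have hint : ∀ {c n : ℤ}, (c : ℂ) / N = n → (N : ℤ) ∣ c := fun {c n} hc => by
    rw [div_eq_iff hN'] at hc
    exact ⟨n, by rw [mul_comm]; exact_mod_cast hc⟩
  -- If N ∤ a the limits would give 0 = `qFrac (k / N)`, which is impossible.
  have ha : (N : ℤ) ∣ a := by
    by_contra ha
    rw [if_neg ha] at h3
    exact qFrac_ne_zero (hne hk) h3.symm
  rw [if_pos ha] at h3
  refine ⟨ha, ?_⟩
  rcases eq_or_eq_neg_of_qFrac_eq (hne fun hb => hab ⟨ha, hb⟩) (hne hk) h3 with ⟨n, hn⟩ | ⟨n, hn⟩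
  · rw [← sub_div] at hn
    exact Or.inl (hint (n := n) (by exact_mod_cast hn))
  · rw [← add_div] at hn
    exact Or.inr (hint (n := n) (by exact_mod_cast hn))

/-- The congruence for the upper left entry follows from the determinant mod N. -/
lemma mem_Gamma1_of_dvd {N : ℕ} {γ : SL(2, ℤ)} (hc : (N : ℤ) ∣ γ 1 0) (hd : (N : ℤ) ∣ γ 1 1 - 1) :
    γ ∈ CongruenceSubgroup.Gamma1 N := by
  have hc' : ((γ 1 0 : ℤ) : ZMod N) = 0 := (ZMod.intCast_zmod_eq_zero_iff_dvd _ _).2 hc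
  have hd' : ((γ 1 1 : ℤ) : ZMod N) = 1 := by
    rw [← sub_eq_zero]
    exact_mod_cast (ZMod.intCast_zmod_eq_zero_iff_dvd _ _).2 hd
  refine (CongruenceSubgroup.Gamma1_mem N γ).2 ⟨?_, hd', hc'⟩
  have h := Matrix.det_fin_two γ.1
  rw [γ.2] at h
  have h1 := congrArg (Int.cast : ℤ → ZMod N) h
  push_cast at h1
  change (1 : ZMod N) = (γ 0 0 : ℤ) * (γ 1 1 : ℤ) - (γ 0 1 : ℤ) * (γ 1 0 : ℤ) at h1
  rw [hc', hd', mul_one, mul_zero, sub_zero] at h1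
  exact h1.symm

/-- The index (kc, kd) must be ±(0, k) mod N; as k is invertible mod N, c ≡ 0 and d ≡ ±1. -/
lemma mem_Gamma1_or_neg_mem {N : ℕ} (hN : 1 < N) {k : ℤ} (hk : IsCoprime k (N : ℤ))
    {γ : SL(2, ℤ)}
    (h : ∀ᶠ τ in codiscrete ℍ, fricke N 0 k (γ • τ) = fricke N 0 k τ) :
    γ ∈ CongruenceSubgroup.Gamma1 N ∨ -γ ∈ CongruenceSubgroup.Gamma1 N := by
  have h0k := not_dvd_of_isCoprime hN hk
  simp only [fricke_smul] at h
  obtain ⟨ha, hb⟩ := index_eq_of_fricke_eq (by omega) (fun h => h0k ⟨dvd_zero _, h⟩)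
    (not_dvd_vecMul h0k γ) h
  rw [zero_mul, zero_add] at ha hb
  have hc := hk.symm.dvd_of_dvd_mul_left ha
  rcases hb with hb | hb
  · refine Or.inl (mem_Gamma1_of_dvd hc (hk.symm.dvd_of_dvd_mul_left (y := k) ?_))
    rwa [mul_sub, mul_one]
  · refine Or.inr (mem_Gamma1_of_dvd ?_ ?_)
    · rw [Matrix.SpecialLinearGroup.coe_neg, Matrix.neg_apply]
      exact hc.neg_right
    · rw [Matrix.SpecialLinearGroup.coe_neg, Matrix.neg_apply, ← neg_add', dvd_neg]
      refine hk.symm.dvd_of_dvd_mul_left (y := k) ?_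
      rwa [mul_add, mul_one]

lemma mem_adjoin_of_mem_modularFunctionField {N : ℕ} (hN : 1 < N) {k : ℤ}
    (hk : IsCoprime k (N : ℤ)) (hf : IsMeromorphic (fricke N 0 k)) {x : MeromorphicField}
    (hx : x ∈ modularFunctionField (CongruenceSubgroup.Gamma1 N) N) :
    x ∈ IntermediateField.adjoin ℂ
      {toField jInv isMeromorphic_jInv, toField (fricke N 0 k) hf} := by
  have hN0 : 0 < N := by omega
  have h0k := not_dvd_of_isCoprime hN hk
  have hfm : toField (fricke N 0 k) hf ∈ modularFunctionField (CongruenceSubgroup.Gamma1 N) N :=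
    ⟨_, hf, rfl, isInvariant_fricke hN0 k, isMeromorphicAtCusps_fricke hN0 h0k⟩
  -- Interpolation on the orbit of f_k: its stabilizer lies in ±Γ₁(N), and −γ acts on `ℍ` as γ does,
  -- so it fixes x.
  obtain ⟨p, hp, hcoeff⟩ := exists_polynomial_of_stabilizer_le (G := SL(2, ℤ))
    (modularFunctionField ⊥ N).toSubfield (smul_mem_modularFunctionField_bot hfm)
    (smul_mem_modularFunctionField_bot hx) (finite_orbit_fricke hN0 hf) (fun γ hγ => by
      obtain ⟨g, hg, rfl, hinv, -⟩ := hx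
      rw [MulAction.mem_stabilizer_iff, smul_toField_eq_self_iff] at hγ ⊢
      rcases mem_Gamma1_or_neg_mem hN hk hγ with h | h
      · exact hinv _ h
      · filter_upwards [hinv _ h] with τ hτ
        rwa [ModularGroup.SL_neg_smul] at hτ)
  rw [← hp, Polynomial.eval_eq_sum]
  refine sum_mem fun n _ => mul_mem ?_ (pow_mem (IntermediateField.subset_adjoin ℂ _ (by simp)) n)
  -- The coefficients are invariant under `SL(2, ℤ)`, hence rational functions of j.
  exact IntermediateField.adjoin.mono ℂ _ _ (by simp)
    (mem_adjoin_jInv_of_smul_eq hN0 (hcoeff n).1 (hcoeff n).2)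

end ModularFunctions

end

theorem proposition6p1 (N : ℕ) (hN : 1 < N) (k : ℤ) (hk : IsCoprime k (N : ℤ)) :
    ∃ (hj : ModularFunctions.IsMeromorphic ModularFunctions.jInv)
      (hf : ModularFunctions.IsMeromorphic (ModularFunctions.fFun N k)),
      IntermediateField.adjoin ℂ
        {ModularFunctions.toField ModularFunctions.jInv hj,
          ModularFunctions.toField (ModularFunctions.fFun N k) hf} =
      ModularFunctions.modularFunctionField (CongruenceSubgroup.Gamma1 N) N := by
  have hN0 : 0 < N := by omega
  have h0k := ModularFunctions.not_dvd_of_isCoprime hN hk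
  rw [ModularFunctions.fFun_eq]
  refine ⟨ModularFunctions.isMeromorphic_jInv, ModularFunctions.isMeromorphic_fricke hN0 h0k,
    le_antisymm ?_ fun x hx =>
      ModularFunctions.mem_adjoin_of_mem_modularFunctionField hN hk _ hx⟩
  rw [IntermediateField.adjoin_le_iff, Set.insert_subset_iff, Set.singleton_subset_iff]
  exact ⟨ModularFunctions.toField_jInv_mem hN0 _, _, _, rfl,
    ModularFunctions.isInvariant_fricke hN0 k,
    ModularFunctions.isMeromorphicAtCusps_fricke hN0 h0k⟩
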